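/- \textbf{Théorème 1.} Let $\mathbf{e}=(e_1,\dots,e_{q_1})$ and $\mathbf{f}=(f_1,\dots,f_{q_2})$ be two finite sequences of positive integers with no common term ($e_i\neq f_j$ for all $i,j$). Put $M:=\max(e_1,\dots,e_{q_1},f_1,\dots,f_{q_2})$ and, for $x\in\mathbb{R}$, $$\Delta(x):=\sum_{i=1}^{q_1}\lfloor e_i x\rfloor-\sum_{j=1}^{q_2}\lfloor f_j x\rfloor .$$ For $n\ge 0$ let $$\mathcal{Q}(n):=\frac{(e_1n)!\cdots(e_{q_1}n)!}{(f_1n)!\cdots(f_{q_2}n)!},\qquad H_n:=\sum_{i=1}^n\frac1i ,$$ and, for $L\in\{1,\dots,M\}$, define in $\mathbb{Q}[[z]]$ $$F(z):=\sum_{n\ge0}\mathcal{Q}(n)z^n,\qquad G_L(z):=\sum_{n\ge1}\mathcal{Q}(n)H_{Ln}z^n,\qquad q_L(z):=\exp\!\left(\frac{G_L(z)}{F(z)}\right).$$ Let $D_L$ be the least common multiple of the integers $1,2,\dots,\lfloor M/L\rfloor$. Assume that $\sum_{i=1}^{q_1}e_i=\sum_{j=1}^{q_2}f_j$ and that $\Delta(x)\ge1$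 for all $x\in[1/M,1)$. Then, for every $L\in\{1,\dots,M\}$, $$q_L(z)^{1/D_L}\in\mathbb{Z}[[z]],$$ where $q_L(z)^{1/D_L}$ denotes the unique power series with constant term $1$ whose $D_L$-th power is $q_L(z)$. -/

import Mathlib

namespace MirrorType

/-- The size `|c|` of a finite sequence `c` of natural numbers: the sum of its terms. -/
def size {q : ℕ} (c : Fin q → ℕ) : ℕ := ∑ i, c i

/-- `M_{e,f}`, the largest of all the terms of `e` and `f` (`0` if both sequences are empty). -/
def maxTerm {q₁ q₂ : ℕ} (e : Fin q₁ → ℕ) (f : Fin q₂ → ℕ) : ℕ :=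
  max (Finset.univ.sup e) (Finset.univ.sup f)

/-- Landau's function `Δ_{e,f}(x) = ∑ ⌊e_i x⌋ - ∑ ⌊f_j x⌋`. -/
noncomputable def landau {q₁ q₂ : ℕ} (e : Fin q₁ → ℕ) (f : Fin q₂ → ℕ) (x : ℝ) : ℤ :=
  ∑ i, ⌊(e i : ℝ) * x⌋ - ∑ j, ⌊(f j : ℝ) * x⌋

/-- The quotient of factorials `Q_{e,f}(n) = ∏ (e_i n)! / ∏ (f_j n)!`, a rational number. -/
def factRatio {q₁ q₂ : ℕ} (e : Fin q₁ → ℕ) (f : Fin q₂ → ℕ) (n : ℕ) : ℚ :=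
  (∏ i, ((e i * n).factorial : ℚ)) / ∏ j, ((f j * n).factorial : ℚ)

/-- `F_{e,f}(z) = ∑_{n ≥ 0} Q_{e,f}(n) z^n`. -/
def seriesF {q₁ q₂ : ℕ} (e : Fin q₁ → ℕ) (f : Fin q₂ → ℕ) : PowerSeries ℚ :=
  PowerSeries.mk fun n => factRatio e f n

/-- `G_{L,e,f}(z) = ∑_{n ≥ 1} Q_{e,f}(n) H_{Ln} z^n`; the term of index `0` vanishes
because `H_0 = 0`. -/
def seriesG {q₁ q₂ : ℕ} (L : ℕ) (e : Fin q₁ → ℕ) (f : Fin q₂ → ℕ) : PowerSeries ℚ :=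
  PowerSeries.mk fun n => factRatio e f n * harmonic (L * n)

/-- The mirror-type map `q_{L,e,f} = exp (G_{L,e,f} / F_{e,f})`, as a formal power series. -/
noncomputable def mirrorType {q₁ q₂ : ℕ} (L : ℕ) (e : Fin q₁ → ℕ) (f : Fin q₂ → ℕ) :
    PowerSeries ℚ :=
  (PowerSeries.exp ℚ).subst (seriesG L e f * (seriesF e f)⁻¹)

/-- `D_L`, the least common multiple of the integers `1, …, ⌊M_{e,f} / L⌋`. -/
def lcmUpTo {q₁ q₂ : ℕ} (L : ℕ) (e : Fin q₁ → ℕ) (f : Fin q₂ → ℕ) : ℕ :=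
  (Finset.Icc 1 (maxTerm e f / L)).lcm id

/-- The series `F_{e,f}` has constant term `1`, so that `(seriesF e f)⁻¹` is a true inverse. -/
theorem constantCoeff_seriesF {q₁ q₂ : ℕ} (e : Fin q₁ → ℕ) (f : Fin q₂ → ℕ) :
    PowerSeries.constantCoeff (seriesF e f) = 1 := by
  rw [← PowerSeries.coeff_zero_eq_constantCoeff_apply]
  simp [seriesF, factRatio]

/-- The series `G_{L,e,f} / F_{e,f}` has no constant term and may be substituted into `exp`. -/
theorem hasSubst_quotient {q₁ q₂ : ℕ} (L : ℕ) (e : Fin q₁ → ℕ) (f : Fin q₂ → ℕ) :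
    PowerSeries.HasSubst (seriesG L e f * (seriesF e f)⁻¹) := by
  apply PowerSeries.HasSubst.of_constantCoeff_zero'
  rw [map_mul, ← PowerSeries.coeff_zero_eq_constantCoeff_apply (seriesG L e f)]
  simp [seriesG]

/-- A series `q` with rational coefficients and constant term `1` has a `d`-th root with integer
coefficients. For `d ≥ 1`, the root `q^{1/d}` is the unique series with constant term `1` whose
`d`-th power is `q`. -/
def HasIntegralRoot (q : PowerSeries ℚ) (d : ℕ) : Prop :=
  ∃ r : PowerSeries ℤ, PowerSeries.constantCoeff r = 1 ∧
    (PowerSeries.map (Int.castRingHom ℚ) r) ^ d = q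

end MirrorType

/-! With D = `lcmUpTo L e f`, the root is exp(G/(DF)), so integrality can be tested one prime p at a
time. Dwork's criterion (`SeriesDvdAt.exp_subst`) makes exp(h) p-integral once h(z^p) - p h(z) is
divisible by p. For h = G/(DF), d = v_p(D) and φ(z) = F(z)/F(z^p), multiplying by F reduces this to
φ(z) G(z^p) ≡ p G(z) mod p^(1+d).

Both sides are compared with ∑ H_{L⌊n/p⌋} Q(n) z^n. The side p G is close to it because p H_{pn} ≡
H_n mod p (`DworkSeq.dvdAt_mul_harmonic_sub`). The other side is treated by summation by parts over
p-adic blocks (`DworkSeq.mk_sub_expand_mul`): block sums are highly divisible by Dwork's congruences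
(`DworkSeq.blockSum_dworkTerm`), while increments of H_{Ln} have controlled denominators
(`dvdAt_harmonic_sub`).

The common measure is μ(w) = `fractCount p M w`. By Legendre's formula and Δ ≥ 1 on [1/M, 1), it
bounds v_p(Q(w)) from below; it also bounds the denominators of the harmonic increments. The extra d
is available because L p^d ≤ M. -/

namespace MirrorType

open Finset PowerSeries

/-- `x` lies in `p ^ k ℤ_(p)`, for a rational number `x`. -/
def DvdAt (p : ℕ) (k : ℤ) (x : ℚ) : Prop := padicNorm p x ≤ (p : ℚ) ^ (-k)

/-- All coefficients of `f` lie in `p ^ k ℤ_(p)`. -/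
def SeriesDvdAt (p : ℕ) (k : ℤ) (f : PowerSeries ℚ) : Prop := ∀ n, DvdAt p k (coeff n f)

/-! ### Divisibility by powers of p for rationals and power series; Dwork's lemma. -/

section DvdAt

theorem DvdAt.zero {p : ℕ} {k : ℤ} : DvdAt p k 0 := by
  simp only [DvdAt, padicNorm.zero]; positivity

theorem DvdAt.neg {p : ℕ} {k : ℤ} {x : ℚ} (hx : DvdAt p k x) : DvdAt p k (-x) := by
  simpa [DvdAt, padicNorm.neg] using hx

variable {p : ℕ} [hp : Fact p.Prime] {k l : ℤ} {x y : ℚ}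

theorem DvdAt.add (hx : DvdAt p k x) (hy : DvdAt p k y) : DvdAt p k (x + y) :=
  padicNorm.nonarchimedean.trans (max_le hx hy)

theorem DvdAt.sub (hx : DvdAt p k x) (hy : DvdAt p k y) : DvdAt p k (x - y) := by
  rw [sub_eq_add_neg]; exact hx.add hy.neg

theorem DvdAt.mono (hx : DvdAt p k x) (h : l ≤ k) : DvdAt p l x :=
  hx.trans (zpow_le_zpow_right₀ (by exact_mod_cast hp.out.one_lt.le) (by lia))

theorem DvdAt.mul (hx : DvdAt p k x) (hy : DvdAt p l y) : DvdAt p (k + l) (x * y) := by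
  have hp0 : (p : ℚ) ≠ 0 := by exact_mod_cast hp.out.ne_zero
  rw [DvdAt, padicNorm.mul, neg_add, zpow_add₀ hp0]
  exact mul_le_mul hx hy (padicNorm.nonneg _) (by positivity)

theorem DvdAt.of_mul {j : ℤ} (hx : DvdAt p k x) (hy : DvdAt p l y) (h : j ≤ k + l) :
    DvdAt p j (x * y) :=
  (hx.mul hy).mono h

theorem DvdAt.sum {ι : Type*} {s : Finset ι} {g : ι → ℚ} (h : ∀ i ∈ s, DvdAt p k (g i)) :
    DvdAt p k (∑ i ∈ s, g i) := by
  classical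
  induction s using Finset.induction_on with
  | empty => simpa using DvdAt.zero
  | insert a s ha ih =>
    rw [Finset.sum_insert ha]
    exact (h a (by simp)).add (ih fun i hi => h i (by simp [hi]))

theorem DvdAt.natCast (a : ℕ) : DvdAt p 0 (a : ℚ) := by
  simpa [DvdAt] using padicNorm.of_nat a

theorem DvdAt.one : DvdAt p 0 1 := by simpa using DvdAt.natCast (p := p) 1

theorem DvdAt.prime : DvdAt p 1 p := by
  simp [DvdAt, padicNorm.padicNorm_p_of_prime]

theorem DvdAt.pow (hx : DvdAt p k x) (n : ℕ) : DvdAt p (n * k) (x ^ n) := by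
  induction n with
  | zero => simpa using DvdAt.one
  | succ n ih => rw [pow_succ]; exact ih.of_mul hx (by push_cast; lia)

theorem DvdAt.of_int_dvd {a : ℤ} {n : ℕ} (h : (p : ℤ) ^ n ∣ a) : DvdAt p n (a : ℚ) := by
  rw [DvdAt, ← padicNorm.dvd_iff_norm_le]; exact_mod_cast h

theorem dvdAt_iff_le_padicValRat (hx : x ≠ 0) : DvdAt p k x ↔ k ≤ padicValRat p x := by
  rw [DvdAt, padicNorm.eq_zpow_of_nonzero hx,
    zpow_le_zpow_iff_right₀ (by exact_mod_cast hp.out.one_lt)]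
  lia

theorem DvdAt.inv_natCast {n : ℕ} (hn : n ≠ 0) : DvdAt p (-padicValNat p n) (n : ℚ)⁻¹ := by
  rw [dvdAt_iff_le_padicValRat (by positivity), padicValRat.inv, padicValRat.of_nat]

theorem exists_int_of_forall_dvdAt (h : ∀ q : ℕ, q.Prime → DvdAt q 0 x) : ∃ a : ℤ, (a : ℚ) = x := by
  refine ⟨x.num, Rat.coe_int_num_of_den_eq_one (Nat.eq_one_iff_not_exists_prime_dvd.2 ?_)⟩
  intro q hq hd
  have : Fact q.Prime := ⟨hq⟩
  have hx : x ≠ 0 := by rintro rfl; simp at hd; exact hq.one_lt.ne' hd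
  have h1 := (dvdAt_iff_le_padicValRat hx).1 (h q hq)
  rw [padicValRat_def] at h1
  have h2 : 1 ≤ padicValNat q x.den := one_le_padicValNat_of_dvd x.den_ne_zero hd
  have h3 : padicValInt q x.num = 0 := by
    apply padicValInt.eq_zero_of_not_dvd
    intro h4
    have := Nat.Coprime.eq_one_of_dvd (x.reduced.symm.coprime_dvd_left hd)
      (Int.natCast_dvd.1 h4)
    exact hq.one_lt.ne' this
  rw [h3] at h1
  lia

/-- Fermat's little theorem for `p`-integral rational numbers. -/
theorem DvdAt.pow_sub_self (hx : DvdAt p 0 x) : DvdAt p 1 (x ^ p - x) := by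
  have hd : ¬ p ∣ x.den := by
    intro hd
    by_cases hx0 : x = 0
    · subst hx0; simp at hd; exact hp.out.one_lt.ne' hd
    have h1 := (dvdAt_iff_le_padicValRat hx0).1 hx
    rw [padicValRat_def] at h1
    have h2 : 1 ≤ padicValNat p x.den := one_le_padicValNat_of_dvd x.den_ne_zero hd
    have h3 : padicValInt p x.num = 0 := by
      apply padicValInt.eq_zero_of_not_dvd
      intro h4
      exact hp.out.one_lt.ne' (Nat.Coprime.eq_one_of_dvd (x.reduced.symm.coprime_dvd_left hd)
        (Int.natCast_dvd.1 h4))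
    rw [h3] at h1
    lia
  have key : (p : ℤ) ∣ x.num ^ p * x.den - x.num * x.den ^ p := by
    rw [← ZMod.intCast_zmod_eq_zero_iff_dvd]
    push_cast
    rw [ZMod.pow_card, ZMod.pow_card, sub_self]
  have h1 : DvdAt p 1 ((x.num ^ p * x.den - x.num * x.den ^ p : ℤ) : ℚ) := by
    exact_mod_cast DvdAt.of_int_dvd (n := 1) (by simpa using key)
  have h2 : DvdAt p 0 (((x.den ^ (p + 1) : ℕ) : ℚ)⁻¹) := by
    have := DvdAt.inv_natCast (p := p) (n := x.den ^ (p + 1)) (pow_ne_zero _ x.den_ne_zero)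
    rwa [padicValNat.pow, padicValNat.eq_zero_of_not_dvd hd, mul_zero, Nat.cast_zero,
      neg_zero] at this
  have h3 := h1.mul h2
  have hd0 : (x.den : ℚ) ≠ 0 := by exact_mod_cast x.den_ne_zero
  have : x ^ p - x = ((x.num ^ p * x.den - x.num * x.den ^ p : ℤ) : ℚ) *
      ((x.den ^ (p + 1) : ℕ) : ℚ)⁻¹ := by
    have hx : x = x.num / x.den := (Rat.num_div_den x).symm
    push_cast
    conv_lhs => rw [hx]
    rw [div_pow]
    field_simp
    ring
  rw [this]
  simpa using h3

end DvdAt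

section SeriesDvdAt

theorem SeriesDvdAt.zero {p : ℕ} {k : ℤ} : SeriesDvdAt p k 0 := fun n => by simpa using DvdAt.zero

theorem SeriesDvdAt.monomial {p : ℕ} {k : ℤ} {x : ℚ} (hx : DvdAt p k x) (n : ℕ) :
    SeriesDvdAt p k (monomial n x) := fun m => by
  rw [coeff_monomial]; split_ifs; exacts [hx, DvdAt.zero]

theorem SeriesDvdAt.C {p : ℕ} {k : ℤ} {x : ℚ} (hx : DvdAt p k x) :
    SeriesDvdAt p k (C x) := by
  rw [← monomial_zero_eq_C_apply]; exact .monomial hx 0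

variable {p : ℕ} [hp : Fact p.Prime] {k l : ℤ} {f g : PowerSeries ℚ}

theorem SeriesDvdAt.add (hf : SeriesDvdAt p k f) (hg : SeriesDvdAt p k g) :
    SeriesDvdAt p k (f + g) := fun n => by rw [map_add]; exact (hf n).add (hg n)

theorem SeriesDvdAt.sub (hf : SeriesDvdAt p k f) (hg : SeriesDvdAt p k g) :
    SeriesDvdAt p k (f - g) := fun n => by rw [map_sub]; exact (hf n).sub (hg n)

theorem SeriesDvdAt.mono (hf : SeriesDvdAt p k f) (h : l ≤ k) : SeriesDvdAt p l f :=
  fun n => (hf n).mono h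

theorem SeriesDvdAt.mul (hf : SeriesDvdAt p k f) (hg : SeriesDvdAt p l g) :
    SeriesDvdAt p (k + l) (f * g) := fun n => by
  rw [coeff_mul]; exact DvdAt.sum fun i _ => (hf _).mul (hg _)

theorem SeriesDvdAt.of_mul {j : ℤ} (hf : SeriesDvdAt p k f) (hg : SeriesDvdAt p l g)
    (h : j ≤ k + l) : SeriesDvdAt p j (f * g) :=
  (hf.mul hg).mono h

theorem SeriesDvdAt.sum {ι : Type*} {s : Finset ι} {g : ι → PowerSeries ℚ}
    (h : ∀ i ∈ s, SeriesDvdAt p k (g i)) : SeriesDvdAt p k (∑ i ∈ s, g i) := fun n => by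
  rw [map_sum]; exact DvdAt.sum fun i hi => h i hi n

theorem SeriesDvdAt.X_pow (n : ℕ) : SeriesDvdAt p 0 (X ^ n : PowerSeries ℚ) := by
  rw [X_pow_eq]; exact .monomial .one n

theorem SeriesDvdAt.one : SeriesDvdAt p 0 (1 : PowerSeries ℚ) := by
  simpa using SeriesDvdAt.X_pow (p := p) 0

theorem SeriesDvdAt.natCast (n : ℕ) : SeriesDvdAt p 0 (n : PowerSeries ℚ) := by
  simpa using SeriesDvdAt.C (DvdAt.natCast (p := p) n)

theorem SeriesDvdAt.prime : SeriesDvdAt p 1 (p : PowerSeries ℚ) := by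
  simpa using SeriesDvdAt.C (DvdAt.prime (p := p))

theorem SeriesDvdAt.pow (hf : SeriesDvdAt p 0 f) (n : ℕ) : SeriesDvdAt p 0 (f ^ n) := by
  induction n with
  | zero => simpa using SeriesDvdAt.one
  | succ n ih => rw [pow_succ]; exact ih.of_mul hf (by simp)

/-- Division by a `p`-integral series with constant term `1`, for coefficients of low degree. -/
theorem DvdAt.coeff_of_mul {u : PowerSeries ℚ} (hu : SeriesDvdAt p 0 u)
    (hu1 : constantCoeff u = 1) {N : ℕ} (h : ∀ n < N, DvdAt p k (coeff n (f * u))) :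
    ∀ n < N, DvdAt p k (coeff n f) := by
  intro n
  induction n using Nat.strong_induction_on with
  | _ n ih =>
    intro hn
    have h1 := h n hn
    rw [coeff_mul, Nat.sum_antidiagonal_eq_sum_range_succ_mk, sum_range_succ, Nat.sub_self,
      coeff_zero_eq_constantCoeff_apply, hu1, mul_one] at h1
    have h2 : DvdAt p k (∑ i ∈ range n, coeff i f * coeff (n - i) u) :=
      DvdAt.sum fun i hi =>
        (ih i (mem_range.1 hi) ((mem_range.1 hi).trans hn)).of_mul (hu _) (by simp)
    simpa using h1.sub h2

theorem SeriesDvdAt.of_mul_right {u : PowerSeries ℚ} (hu : SeriesDvdAt p 0 u)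
    (hu1 : constantCoeff u = 1) (h : SeriesDvdAt p k (f * u)) : SeriesDvdAt p k f :=
  fun n => DvdAt.coeff_of_mul hu hu1 (N := n + 1) (fun m _ => h m) n n.lt_succ_self

/-- Frobenius modulo p, one monomial at a time: the mixed binomial terms carry a factor p, and
Fermat's little theorem handles the new coefficient. -/
theorem SeriesDvdAt.sum_monomial_pow_sub_expand {c : ℕ → ℚ} (hc : ∀ n, DvdAt p 0 (c n)) (N : ℕ) :
    SeriesDvdAt p 1 ((∑ i ∈ range N, PowerSeries.monomial i (c i)) ^ p -
      PowerSeries.expand p hp.out.ne_zero (∑ i ∈ range N, PowerSeries.monomial i (c i))) := by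
  induction N with
  | zero => simpa [zero_pow hp.out.ne_zero] using SeriesDvdAt.zero
  | succ N ih =>
    rw [sum_range_succ, map_add, add_pow_prime_eq' hp.out, expand_monomial, monomial_pow]
    set A := ∑ i ∈ range N, PowerSeries.monomial i (c i)
    have hA : SeriesDvdAt p 0 A := .sum fun i _ => .monomial (hc i) i
    have h1 : SeriesDvdAt p 1 ((p : PowerSeries ℚ) * ∑ k ∈ Ioo 0 p, A ^ k *
        PowerSeries.monomial N (c N) ^ (p - k) * ↑(p.choose k / p)) := by
      refine SeriesDvdAt.prime.of_mul (l := 0) (.sum fun i _ => ?_) (by simp)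
      refine SeriesDvdAt.of_mul (k := 0) (l := 0) ?_ (.natCast _) (by simp)
      exact (hA.pow _).of_mul ((SeriesDvdAt.monomial (hc N) N).pow _) (by simp)
    have h2 : SeriesDvdAt p 1 (PowerSeries.monomial (p * N) (c N ^ p - c N)) :=
      .monomial (hc N).pow_sub_self _
    have := (ih.add h1).add h2
    rw [map_sub] at this
    convert this using 1
    ring

/-- Dwork's lemma: the coefficients of `f` are `p`-integral if `f(z ^ p) = f(z) ^ p (1 + w(z))` with
`w ∈ p z ℤ_(p)[[z]]`. -/
theorem SeriesDvdAt.of_expand_eq_pow_mul {w : PowerSeries ℚ} (hf1 : constantCoeff f = 1)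
    (hw : SeriesDvdAt p 1 w) (hw0 : constantCoeff w = 0)
    (h : PowerSeries.expand p hp.out.ne_zero f = f ^ p * (1 + w)) : SeriesDvdAt p 0 f := by
  intro n
  induction n using Nat.strong_induction_on with
  | _ n ih =>
    rcases Nat.eq_zero_or_pos n with rfl | hn
    · simpa [hf1] using DvdAt.one
    set c : ℕ → ℚ := fun i => if i < n then coeff i f else 0 with hc_def
    have hc : ∀ i, DvdAt p 0 (c i) := by
      intro i
      simp only [hc_def]
      split_ifs with hi
      exacts [ih i hi, DvdAt.zero]
    -- Truncation of `f` below degree n. In degree n, f^p differs from g^p only by p times the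
    -- unknown coefficient, whereas f(z^p) involves only lower coefficients; the functional equation
    -- can thus be solved for that coefficient.
    set g : PowerSeries ℚ := ∑ i ∈ range n, PowerSeries.monomial i (c i) with hg
    have hgi : SeriesDvdAt p 0 g := .sum fun i _ => .monomial (hc i) i
    have hgc : ∀ i, coeff i g = c i := by
      intro i
      rw [hg, map_sum]
      simp only [coeff_monomial]
      rw [Finset.sum_ite_eq]
      simp only [mem_range, hc_def]
      split_ifs <;> rfl
    obtain ⟨T, hT⟩ : X ^ n ∣ f - g := by
      rw [X_pow_dvd_iff]
      intro m hm
      rw [map_sub, hgc, hc_def]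
      simp [hm]
    have hfg : f = g + X ^ n * T := by rw [← hT]; ring
    have hT0 : constantCoeff T = coeff n f := by
      have : coeff n f = coeff n g + coeff n (X ^ n * T) := by rw [← map_add, ← hfg]
      rw [hgc, coeff_X_pow_mul', if_pos le_rfl, Nat.sub_self] at this
      simp [hc_def] at this
      exact this.symm
    have hg1 : constantCoeff g = 1 := by
      rw [← coeff_zero_eq_constantCoeff_apply, hgc]
      simp [hc_def, hn, hf1]
    obtain ⟨K, hK⟩ := Polynomial.powAddExpansion g (X ^ n * T) p
    rw [← hfg] at hK
    have hK' : f ^ p = g ^ p + X ^ n * ((p : PowerSeries ℚ) * g ^ (p - 1) * T + X ^ n * (K * T ^ 2)) := by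
      rw [hK]; ring
    have hlow : ∀ m < n, coeff m (f ^ p) = coeff m (g ^ p) := by
      intro m hm
      rw [hK', map_add, coeff_X_pow_mul', if_neg (by lia), add_zero]
    have htop : coeff n (f ^ p) = coeff n (g ^ p) + p * coeff n f := by
      rw [hK', map_add, coeff_X_pow_mul', if_pos le_rfl, Nat.sub_self,
        coeff_zero_eq_constantCoeff_apply]
      simp [hg1, hT0, hn.ne']
    have hw1 : DvdAt p 1 (coeff n (f ^ p * w)) := by
      rw [coeff_mul]
      refine DvdAt.sum fun i hi => ?_
      rw [HasAntidiagonal.mem_antidiagonal] at hi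
      rcases Nat.eq_zero_or_pos i.2 with h0 | h0
      · rw [h0, coeff_zero_eq_constantCoeff_apply w, hw0, mul_zero]
        exact DvdAt.zero
      · rw [hlow _ (by lia)]
        exact (hgi.pow p _).of_mul (hw _) (by simp)
    have hcomp : coeff n (PowerSeries.expand p hp.out.ne_zero f) =
        coeff n (PowerSeries.expand p hp.out.ne_zero g) := by
      rw [coeff_expand, coeff_expand, hgc]
      simp [hc_def, Nat.div_lt_self hn hp.out.one_lt]
    have hF := SeriesDvdAt.sum_monomial_pow_sub_expand hc n n
    rw [← hg, map_sub] at hF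
    have heq : p * coeff n f = -(coeff n (g ^ p) -
        coeff n (PowerSeries.expand p hp.out.ne_zero g)) - coeff n (f ^ p * w) := by
      rw [← hcomp, h, mul_add, mul_one, map_add, htop]
      ring
    have hpf : DvdAt p 1 (p * coeff n f) := by
      rw [heq]; exact hF.neg.sub hw1
    have hpinv : DvdAt p (-1) (p : ℚ)⁻¹ := by
      simpa using DvdAt.inv_natCast (p := p) hp.out.ne_zero
    have hp0 : (p : ℚ) ≠ 0 := by exact_mod_cast hp.out.ne_zero
    simpa [hp0] using hpinv.mul hpf

end SeriesDvdAt

/-! ### Exponentials of power series and their integrality. -/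

section Exp

variable {a b h : PowerSeries ℚ}

theorem constantCoeff_exp_subst (ha : constantCoeff a = 0) :
    constantCoeff ((exp ℚ).subst a) = 1 := by
  have hs := HasSubst.of_constantCoeff_zero' ha
  rw [← coeff_zero_eq_constantCoeff_apply, coeff_subst' hs, finsum_eq_single _ 0]
  · simp
  · intro n hn
    simp [ha, hn]

theorem derivative_exp_subst (ha : constantCoeff a = 0) :
    d⁄dX ℚ ((exp ℚ).subst a) = (exp ℚ).subst a * d⁄dX ℚ a := by
  rw [derivative_subst (HasSubst.of_constantCoeff_zero' ha), derivative_exp]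

/-- The quotient of the two solutions has zero derivative. All functional equations of exp below are
deduced from this uniqueness. -/
theorem exp_subst_unique (ha : constantCoeff a = 0) {y : PowerSeries ℚ}
    (hy1 : constantCoeff y = 1) (hy : d⁄dX ℚ y = y * d⁄dX ℚ a) : y = (exp ℚ).subst a := by
  have h0 : constantCoeff ((exp ℚ).subst a) ≠ 0 := by simp [constantCoeff_exp_subst ha]
  have key : y * ((exp ℚ).subst a)⁻¹ = 1 := by
    apply derivative.ext
    · rw [Derivation.leibniz, derivative_inv', derivative_exp_subst ha, hy, smul_eq_mul,
        smul_eq_mul]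
      have h1 := PowerSeries.mul_inv_cancel _ h0
      simp only [Derivation.map_one_eq_zero]
      linear_combination (-y * ((exp ℚ).subst a)⁻¹ * d⁄dX ℚ a) * h1
    · simp [hy1, constantCoeff_exp_subst ha]
  rw [← mul_one ((exp ℚ).subst a), ← key, mul_left_comm, PowerSeries.mul_inv_cancel _ h0, mul_one]

theorem exp_subst_add (ha : constantCoeff a = 0) (hb : constantCoeff b = 0) :
    (exp ℚ).subst (a + b) = (exp ℚ).subst a * (exp ℚ).subst b := by
  symm
  apply exp_subst_unique
  · simp [ha, hb]
  · simp [constantCoeff_exp_subst, ha, hb]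
  · rw [Derivation.leibniz, derivative_exp_subst ha, derivative_exp_subst hb, map_add, smul_eq_mul,
      smul_eq_mul]
    ring

theorem exp_subst_nsmul (ha : constantCoeff a = 0) (n : ℕ) :
    (exp ℚ).subst ((n : PowerSeries ℚ) * a) = ((exp ℚ).subst a) ^ n := by
  induction n with
  | zero =>
    symm
    apply exp_subst_unique <;> simp
  | succ n ih => rw [Nat.cast_succ, add_mul, one_mul, exp_subst_add (by simp [ha]) ha, ih, pow_succ]

theorem DvdAt.prime_pow_div_factorial {p : ℕ} [hp : Fact p.Prime] {n : ℕ} (hn : n ≠ 0) :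
    DvdAt p 1 ((p : ℚ) ^ n * ((n.factorial : ℕ) : ℚ)⁻¹) := by
  have h1 := (DvdAt.prime (p := p)).pow n
  refine h1.of_mul (DvdAt.inv_natCast n.factorial_ne_zero) ?_
  have := padicValNat_factorial_lt_of_ne_zero p hn
  lia

/-- Writing a = p y with y integral, the terms are (p^n / n!) y^n, and v_p(n!) < n for n ≥ 1. -/
theorem SeriesDvdAt.exp_subst_sub_one {p : ℕ} [hp : Fact p.Prime] (ha : constantCoeff a = 0)
    (h : SeriesDvdAt p 1 a) : SeriesDvdAt p 1 ((exp ℚ).subst a - 1) := by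
  have hp0 : (p : ℚ) ≠ 0 := by exact_mod_cast hp.out.ne_zero
  obtain ⟨y, hy, hay⟩ : ∃ y, SeriesDvdAt p 0 y ∧ a = PowerSeries.C (p : ℚ) * y := by
    refine ⟨PowerSeries.C (p : ℚ)⁻¹ * a, ?_, ?_⟩
    · have : DvdAt p (-1) (p : ℚ)⁻¹ := by simpa using DvdAt.inv_natCast (p := p) hp.out.ne_zero
      exact (SeriesDvdAt.C this).of_mul h (by simp)
    · rw [← mul_assoc, ← map_mul, mul_inv_cancel₀ hp0, map_one, one_mul]
  intro n
  have hs := HasSubst.of_constantCoeff_zero' ha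
  have hterm : ∀ d, d ≠ 0 → DvdAt p 1 (coeff d (exp ℚ) • coeff n (a ^ d)) := by
    intro d hd
    have : coeff d (exp ℚ) • coeff n (a ^ d) =
        ((p : ℚ) ^ d * ((d.factorial : ℕ) : ℚ)⁻¹) * coeff n (y ^ d) := by
      rw [hay, mul_pow, ← map_pow, coeff_C_mul, coeff_exp]
      simp
      ring
    rw [this]
    exact (DvdAt.prime_pow_div_factorial hd).of_mul (hy.pow d n) (by simp)
  rcases Nat.eq_zero_or_pos n with rfl | hn
  · simpa [constantCoeff_exp_subst ha] using DvdAt.zero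
  rw [map_sub, coeff_one, if_neg hn.ne', sub_zero, coeff_subst' hs]
  refine finsum_induction (DvdAt p 1) DvdAt.zero (fun _ _ => DvdAt.add) ?_
  intro d
  rcases Nat.eq_zero_or_pos d with rfl | hd
  · simpa [coeff_one, hn.ne'] using DvdAt.zero
  · exact hterm d hd.ne'

/-- If `h(z ^ p) - p h(z)` has coefficients in `p ℤ_(p)`, then `exp h` is `p`-integral. -/
theorem SeriesDvdAt.exp_subst {p : ℕ} [hp : Fact p.Prime] (hh : constantCoeff h = 0)
    (H : SeriesDvdAt p 1 (PowerSeries.expand p hp.out.ne_zero h - (p : PowerSeries ℚ) * h)) :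
    SeriesDvdAt p 0 ((exp ℚ).subst h) := by
  set a : PowerSeries ℚ := PowerSeries.expand p hp.out.ne_zero h - (p : PowerSeries ℚ) * h with ha_def
  have ha : constantCoeff a = 0 := by simp [ha_def, hh]
  refine SeriesDvdAt.of_expand_eq_pow_mul (w := (exp ℚ).subst a - 1)
    (constantCoeff_exp_subst hh) (.exp_subst_sub_one ha H)
    (by simp [constantCoeff_exp_subst ha]) ?_
  rw [add_sub_cancel, ← exp_subst_nsmul hh, ← exp_subst_add (by simp [hh]) ha, ha_def,
    add_sub_cancel]
  exact expand_subst _ _ (HasSubst.of_constantCoeff_zero' hh) _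

theorem hasIntegralRoot_exp_subst {d : ℕ} (hd : d ≠ 0) (hh : constantCoeff h = 0)
    (H : ∀ p : ℕ, p.Prime → SeriesDvdAt p 0 ((exp ℚ).subst (PowerSeries.C (d : ℚ)⁻¹ * h))) :
    HasIntegralRoot ((exp ℚ).subst h) d := by
  have hd0 : (d : ℚ) ≠ 0 := by exact_mod_cast hd
  have hh' : constantCoeff (PowerSeries.C (d : ℚ)⁻¹ * h) = 0 := by simp [hh]
  choose r hr using fun n => exists_int_of_forall_dvdAt (fun p hp => H p hp n)
  have hmap : PowerSeries.map (Int.castRingHom ℚ) (PowerSeries.mk r) =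
      (exp ℚ).subst (PowerSeries.C (d : ℚ)⁻¹ * h) := by
    ext n; simp [hr]
  refine ⟨PowerSeries.mk r, ?_, ?_⟩
  · have := hr 0
    rw [coeff_zero_eq_constantCoeff_apply, constantCoeff_exp_subst hh'] at this
    rw [← coeff_zero_eq_constantCoeff_apply, coeff_mk]
    exact_mod_cast this
  · rw [hmap, ← exp_subst_nsmul hh', ← mul_assoc]
    congr 1
    rw [← map_natCast (PowerSeries.C (R := ℚ)), ← map_mul, mul_inv_cancel₀ hd0, map_one, one_mul]

end Exp

end MirrorType

/-! ### Counting large fractional parts of w / p^l. -/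

namespace MirrorType

open Finset

/-- The number of `l ≥ 1` such that the fractional part of `w / p ^ l` is at least `1 / M`. -/
def fractCount (p M w : ℕ) : ℕ := #{l ∈ Icc 1 (M * w) | p ^ l ≤ M * (w % p ^ l)}

section fractCount

variable {p M w : ℕ}

/-- Shows that the cutoff M w in `fractCount` loses no level. -/
theorem lt_pow_of_pow_le_mul_mod (hp : p.Prime) {l : ℕ} (h : p ^ l ≤ M * (w % p ^ l)) :
    l ≤ M * w :=
  (Nat.lt_pow_self hp.one_lt).le.trans (h.trans (Nat.mul_le_mul_left _ (Nat.mod_le _ _)))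

theorem le_fractCount_of_forall (hp : p.Prime) {a n : ℕ}
    (h : ∀ l ∈ Ioc a (a + n), p ^ l ≤ M * (w % p ^ l)) : n ≤ fractCount p M w := by
  have : Ioc a (a + n) ⊆ {l ∈ Icc 1 (M * w) | p ^ l ≤ M * (w % p ^ l)} := by
    intro l hl
    rw [mem_filter, mem_Icc]
    have hl' := mem_Ioc.1 hl
    exact ⟨⟨by lia, lt_pow_of_pow_le_mul_mod hp (h l hl)⟩, h l hl⟩
  simpa [fractCount] using card_le_card this

theorem fractCount_zero : fractCount p M 0 = 0 := by simp [fractCount]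

theorem fractCount_lt (hp : p.Prime) {t : ℕ} (ht : 0 < t) (h : M * w < p ^ t) :
    fractCount p M w < t := by
  have : {l ∈ Icc 1 (M * w) | p ^ l ≤ M * (w % p ^ l)} ⊆ Ico 1 t := by
    intro l hl
    rw [mem_filter, mem_Icc] at hl
    rw [mem_Ico]
    refine ⟨hl.1.1, ?_⟩
    rw [← Nat.pow_lt_pow_iff_right hp.one_lt]
    exact (hl.2.trans (Nat.mul_le_mul_left _ (Nat.mod_le _ _))).trans_lt h
  have := card_le_card this
  rw [Nat.card_Ico] at this
  rw [fractCount]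
  lia

/-- The d levels just above s = v_p(w) all count: there w mod p^l is a nonzero multiple of p^s,
hence at least p^(l-d). -/
theorem le_fractCount_of_pos (hp : p.Prime) {d : ℕ} (hd : p ^ d ≤ M) (hw : 0 < w) :
    d ≤ fractCount p M w := by
  have := Fact.mk hp
  set s := padicValNat p w
  apply le_fractCount_of_forall hp (a := s)
  intro l hl
  rw [mem_Ioc] at hl
  have hs : p ^ s ∣ w % p ^ l :=
    (Nat.dvd_mod_iff (pow_dvd_pow p hl.1.le)).2 pow_padicValNat_dvd
  have h0 : w % p ^ l ≠ 0 := by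
    intro h
    have := (padicValNat_dvd_iff_le hw.ne').1 (Nat.dvd_of_mod_eq_zero h)
    lia
  calc p ^ l ≤ p ^ d * p ^ s := by rw [← pow_add]; exact Nat.pow_le_pow_right hp.pos (by lia)
    _ ≤ M * (w % p ^ l) := Nat.mul_le_mul hd (Nat.le_of_dvd (Nat.pos_of_ne_zero h0) hs)

/-- If `L m p < k ≤ L w` where `w = b + m p` with `0 ≤ b < p`, then the `p`-adic valuation of `k` is
bounded by `fractCount p M w`. -/
theorem padicValNat_add_le_fractCount (hp : p.Prime) {L d b m k : ℕ} (hb : b < p)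
    (hd : L * p ^ d ≤ M) (hL : 0 < L) (hk : L * m * p < k) (hk' : k ≤ L * (b + m * p)) :
    padicValNat p k + d ≤ fractCount p M (b + m * p) := by
  have := Fact.mk hp
  have hpd : p ^ d ≤ M := (Nat.le_mul_of_pos_left _ hL).trans hd
  rcases Nat.eq_zero_or_pos (padicValNat p k) with hr | hr
  · rw [hr, zero_add]
    apply le_fractCount_of_pos hp hpd
    by_contra h0
    have : b + m * p = 0 := by lia
    rw [this] at hk'
    lia
  -- Removing from k the multiple p^l L ⌊m / p^(l-1)⌋ leaves a positive multiple of p^l which is at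
  -- most L (w mod p^l).
  have key : ∀ l, 0 < l → l ≤ padicValNat p k → p ^ l ≤ L * ((b + m * p) % p ^ l) := by
    intro l hl hlr
    obtain ⟨i, rfl⟩ : ∃ i, l = i + 1 := ⟨l - 1, by lia⟩
    have hmod : (b + m * p) % p ^ (i + 1) = b + p * (m % p ^ i) := by
      rw [pow_succ', Nat.mod_mul, Nat.add_mul_mod_self_right, Nat.mod_eq_of_lt hb,
        Nat.add_mul_div_right _ _ hp.pos, Nat.div_eq_of_lt hb, zero_add]
    have hdvd : p ^ (i + 1) ∣ k := (pow_dvd_pow p hlr).trans pow_padicValNat_dvd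
    obtain ⟨c, hc⟩ : ∃ c, k = L * m * p + c := ⟨k - L * m * p, by lia⟩
    have hm := Nat.div_add_mod m (p ^ i)
    have hk2 : k = p ^ (i + 1) * (L * (m / p ^ i)) + (L * p * (m % p ^ i) + c) := by
      rw [hc]
      conv_lhs => rw [← hm]
      ring
    rw [hk2, Nat.dvd_add_right (Dvd.intro _ rfl)] at hdvd
    have hle := Nat.le_of_dvd (by lia) hdvd
    rw [hmod]
    have hcb : c ≤ L * b := by
      have : L * (b + m * p) = L * m * p + L * b := by ring
      lia
    calc p ^ (i + 1) ≤ L * p * (m % p ^ i) + c := hle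
      _ ≤ L * p * (m % p ^ i) + L * b := by lia
      _ = L * (b + p * (m % p ^ i)) := by ring
  apply le_fractCount_of_forall hp (a := 0)
  intro l hl
  rw [mem_Ioc, zero_add] at hl
  have hLM : L ≤ M := (Nat.le_mul_of_pos_right _ (pow_pos hp.pos d)).trans hd
  rcases le_or_gt l (padicValNat p k) with hlr | hlr
  · exact (key l hl.1 hlr).trans (Nat.mul_le_mul_right _ hLM)
  -- For the d levels above r, the residue of w is at least its residue mod p^r, and L p^d ≤ M makes
  -- up for the larger modulus.
  · set r := padicValNat p k
    have h1 : (b + m * p) % p ^ r ≤ (b + m * p) % p ^ l := by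
      rw [← Nat.mod_mod_of_dvd (b + m * p) (pow_dvd_pow p hlr.le)]
      exact Nat.mod_le _ _
    calc p ^ l ≤ p ^ d * p ^ r := by rw [← pow_add]; exact Nat.pow_le_pow_right hp.pos (by lia)
      _ ≤ p ^ d * (L * ((b + m * p) % p ^ r)) := Nat.mul_le_mul_left _ (key r hr le_rfl)
      _ ≤ p ^ d * (L * ((b + m * p) % p ^ l)) := by gcongr
      _ = L * p ^ d * ((b + m * p) % p ^ l) := by ring
      _ ≤ M * ((b + m * p) % p ^ l) := Nat.mul_le_mul_right _ hd

/-- Adding to `m p ^ t` a number `n < p ^ t` all of whose relevant fractional parts are large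
increases the count by at least `t`. -/
theorem add_fractCount_le (hp : p.Prime) {t n m : ℕ} (hn : n < p ^ t)
    (h : ∀ l ∈ Icc 1 t, p ^ l ≤ M * (n % p ^ l)) :
    t + fractCount p M m ≤ fractCount p M (n + m * p ^ t) := by
  -- Levels up to t are decided by n alone; a level i counted for m becomes level t + i.
  have hsub : Icc 1 t ∪ {l ∈ Icc 1 (M * m) | p ^ l ≤ M * (m % p ^ l)}.map (addLeftEmbedding t) ⊆
      {l ∈ Icc 1 (M * (n + m * p ^ t)) |
        p ^ l ≤ M * ((n + m * p ^ t) % p ^ l)} := by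
    intro l hl
    have hl' : 1 ≤ l ∧ p ^ l ≤ M * ((n + m * p ^ t) % p ^ l) := by
      rw [mem_union] at hl
      rcases hl with hl | hl
      · refine ⟨(mem_Icc.1 hl).1, ?_⟩
        have : (n + m * p ^ t) % p ^ l = n % p ^ l := by
          obtain ⟨c, hc⟩ := pow_dvd_pow p (mem_Icc.1 hl).2
          rw [hc, mul_left_comm, Nat.add_mul_mod_self_left]
        rw [this]
        exact h l hl
      · rw [mem_map] at hl
        obtain ⟨i, hi, rfl⟩ := hl
        rw [mem_filter, mem_Icc] at hi
        rw [addLeftEmbedding_apply]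
        refine ⟨by lia, ?_⟩
        rw [pow_add, Nat.mod_mul, Nat.add_mul_mod_self_right, Nat.mod_eq_of_lt hn,
          Nat.add_mul_div_right _ _ (pow_pos hp.pos t), Nat.div_eq_of_lt hn, zero_add]
        calc p ^ t * p ^ i ≤ p ^ t * (M * (m % p ^ i)) := Nat.mul_le_mul_left _ hi.2
          _ = M * (p ^ t * (m % p ^ i)) := by ring
          _ ≤ M * (n + p ^ t * (m % p ^ i)) := Nat.mul_le_mul_left _ (Nat.le_add_left _ _)
    rw [mem_filter, mem_Icc]
    exact ⟨⟨hl'.1, lt_pow_of_pow_le_mul_mod hp hl'.2⟩, hl'.2⟩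
  have hdisj : Disjoint (Icc 1 t)
      ({l ∈ Icc 1 (M * m) | p ^ l ≤ M * (m % p ^ l)}.map (addLeftEmbedding t)) := by
    rw [disjoint_left]
    intro l hl hl2
    rw [mem_map] at hl2
    obtain ⟨i, hi, rfl⟩ := hl2
    rw [mem_filter, mem_Icc] at hi
    rw [addLeftEmbedding_apply, mem_Icc] at hl
    lia
  have := card_le_card hsub
  rw [card_union_of_disjoint hdisj, card_map, Nat.card_Icc] at this
  simpa [fractCount] using this

/-- If `u / p ^ t` is less than `1 / M` but `n / p ^ (t + 1)` is not, where `n = v + u p`, then all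
fractional parts of `n / p ^ l` for `l ≤ t + 1` are at least `1 / M`. -/
theorem pow_le_mul_mod_of_first {t u v : ℕ} (hu : M * u < p ^ t) (hv : v < p)
    (hn : p ^ (t + 1) ≤ M * (v + u * p)) :
    ∀ l ∈ Icc 1 (t + 1), p ^ l ≤ M * ((v + u * p) % p ^ l) := by
  intro l hl
  rw [mem_Icc] at hl
  obtain ⟨i, rfl⟩ : ∃ i, l = i + 1 := ⟨l - 1, by lia⟩
  have hp0 : 0 < p := by lia
  set n := v + u * p
  have hdm := Nat.div_add_mod n (p ^ (i + 1))
  have hsplit : p ^ t = p ^ i * p ^ (t - i) := by rw [← pow_add]; congr 1; lia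
  have hdiv : n / p ^ (i + 1) = u / p ^ i := by
    rw [pow_succ', ← Nat.div_div_eq_div_mul, Nat.add_mul_div_right _ _ hp0, Nat.div_eq_of_lt hv,
      zero_add]
  have h1 : M * (u / p ^ i) < p ^ (t - i) := by
    have h2 : p ^ i * (M * (u / p ^ i)) < p ^ i * p ^ (t - i) := by
      rw [← hsplit]
      refine lt_of_le_of_lt ?_ hu
      calc p ^ i * (M * (u / p ^ i)) = M * (u / p ^ i * p ^ i) := by ring
        _ ≤ M * u := Nat.mul_le_mul_left _ (Nat.div_mul_le_self _ _)
    exact lt_of_mul_lt_mul_left h2 (Nat.zero_le _)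
  rw [hdiv] at hdm
  have h3 : M * n = p ^ (i + 1) * (M * (u / p ^ i)) + M * (n % p ^ (i + 1)) := by
    conv_lhs => rw [← hdm]
    ring
  have h4 : p ^ (i + 1) * (M * (u / p ^ i) + 1) ≤ p ^ (i + 1) * p ^ (t - i) :=
    Nat.mul_le_mul_left _ h1
  have h5 : p ^ (i + 1) * p ^ (t - i) = p ^ (t + 1) := by rw [← pow_add]; congr 1; lia
  rw [mul_add, mul_one, h5] at h4
  lia

end fractCount

/-! ### Lower bound for the valuation of the factorial ratios. -/

section factRatio

variable {q₁ q₂ : ℕ} {e : Fin q₁ → ℕ} {f : Fin q₂ → ℕ}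

theorem le_maxTerm_left (i : Fin q₁) : e i ≤ maxTerm e f :=
  (Finset.le_sup (f := e) (mem_univ i)).trans (le_max_left _ _)

theorem le_maxTerm_right (j : Fin q₂) : f j ≤ maxTerm e f :=
  (Finset.le_sup (f := f) (mem_univ j)).trans (le_max_right _ _)

theorem factRatio_ne_zero (n : ℕ) : factRatio e f n ≠ 0 := by
  rw [factRatio]; positivity

theorem floor_mul_div (a r N : ℕ) : ⌊(a : ℝ) * ((r : ℝ) / N)⌋ = ((a * r / N : ℕ) : ℤ) := by
  rw [← mul_div_assoc, ← Nat.cast_mul, ← Nat.floor_div_eq_div (K := ℝ), Int.natCast_floor_eq_floor]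
  positivity

/-- Equality of sizes lets w be replaced by w mod N. If the fractional part is below 1/M all floors
vanish; otherwise the hypothesis on Δ applies. -/
theorem indicator_le_sum_div_sub (hsize : size e = size f)
    (hΔ : ∀ x ∈ Set.Ico (1 / (maxTerm e f : ℝ)) 1, 1 ≤ landau e f x) {N : ℕ} (hN : 0 < N) (w : ℕ) :
    (if N ≤ maxTerm e f * (w % N) then 1 else 0 : ℤ) ≤
      ∑ i, ((e i * w / N : ℕ) : ℤ) - ∑ j, ((f j * w / N : ℕ) : ℤ) := by
  have hdiv : ∀ a : ℕ, ((a * w / N : ℕ) : ℤ) = (a : ℤ) * (w / N : ℕ) + (a * (w % N) / N : ℕ) := by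
    intro a
    rw [← Nat.cast_mul, ← Nat.cast_add]
    congr 1
    conv_lhs => rw [← Nat.div_add_mod w N, mul_add, mul_left_comm, Nat.mul_add_div hN]
  have hs : (∑ i, (e i : ℤ)) = ∑ j, (f j : ℤ) := by exact_mod_cast hsize
  simp only [hdiv, sum_add_distrib, ← sum_mul, hs, add_sub_add_left_eq_sub]
  split_ifs with h
  · have hM : 0 < maxTerm e f := by
      by_contra h0
      simp [Nat.eq_zero_of_not_pos h0] at h
      lia
    have h1 := hΔ ((w % N : ℕ) / (N : ℝ)) ⟨by
        rw [div_le_div_iff₀ (by exact_mod_cast hM) (by exact_mod_cast hN), one_mul, mul_comm]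
        exact_mod_cast h, by
        rw [div_lt_one (by exact_mod_cast hN)]
        exact_mod_cast Nat.mod_lt _ hN⟩
    simpa only [landau, floor_mul_div] using h1
  · have h0 : ∀ a ≤ maxTerm e f, a * (w % N) / N = 0 := fun a ha =>
      Nat.div_eq_of_lt ((Nat.mul_le_mul_right _ ha).trans_lt (not_le.1 h))
    simp [h0 _ (le_maxTerm_left _), h0 _ (le_maxTerm_right _)]

theorem padicValRat_prod {p : ℕ} [Fact p.Prime] {ι : Type*} (s : Finset ι) (g : ι → ℚ)
    (hg : ∀ i ∈ s, g i ≠ 0) : padicValRat p (∏ i ∈ s, g i) = ∑ i ∈ s, padicValRat p (g i) := by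
  classical
  induction s using Finset.induction_on with
  | empty => simp
  | insert a s ha ih =>
    rw [prod_insert ha, sum_insert ha, padicValRat.mul (hg a (by simp))
      (prod_ne_zero_iff.2 fun i hi => hg i (by simp [hi])), ih fun i hi => hg i (by simp [hi])]

theorem dvdAt_factRatio {p : ℕ} [hp : Fact p.Prime] (hsize : size e = size f)
    (hΔ : ∀ x ∈ Set.Ico (1 / (maxTerm e f : ℝ)) 1, 1 ≤ landau e f x) (w : ℕ) :
    DvdAt p (fractCount p (maxTerm e f) w) (factRatio e f w) := by
  rw [dvdAt_iff_le_padicValRat (factRatio_ne_zero w)]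
  set M := maxTerm e f
  -- Legendre's formula, over the range of levels of `fractCount` for every a, so that the sums can
  -- be compared level by level.
  have hval : ∀ a ≤ M, padicValRat p ((a * w).factorial : ℚ) =
      ∑ l ∈ Icc 1 (M * w), ((a * w / p ^ l : ℕ) : ℤ) := by
    intro a ha
    have hle : a * w ≤ M * w := Nat.mul_le_mul_right _ ha
    rw [padicValRat.of_nat, padicValNat_factorial (b := M * w + 1)
      ((Nat.log_le_self _ _).trans_lt (by lia))]
    push_cast
    rfl
  have h0 : ∀ n : ℕ, (n.factorial : ℚ) ≠ 0 := fun n => by positivity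
  rw [factRatio, padicValRat.div (prod_ne_zero_iff.2 fun _ _ => h0 _)
    (prod_ne_zero_iff.2 fun _ _ => h0 _), padicValRat_prod _ _ fun _ _ => h0 _,
    padicValRat_prod _ _ fun _ _ => h0 _]
  simp only [hval _ (le_maxTerm_left _), hval _ (le_maxTerm_right _)]
  rw [sum_comm, sum_comm (s := univ) (t := Icc 1 (M * w)), ← sum_sub_distrib, fractCount,
    card_filter, Nat.cast_sum]
  refine sum_le_sum fun l _ => ?_
  simpa using indicator_le_sum_div_sub hsize hΔ (pow_pos hp.out.pos l) w

end factRatio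

end MirrorType

/-! ### Multiplicative congruences between factorial ratios. -/

namespace MirrorType

open Finset

section DvdAtSubOne

variable {p : ℕ} [hp : Fact p.Prime] {c : ℤ} {x y : ℚ}

theorem DvdAt.of_sub_one (hc : 0 ≤ c) (hx : DvdAt p c (x - 1)) : DvdAt p 0 x := by
  simpa using (hx.mono hc).add DvdAt.one

theorem DvdAt.inv_of_sub_one (hc : 0 < c) (hx : DvdAt p c (x - 1)) : DvdAt p 0 x⁻¹ := by
  have h1 : padicNorm p (x - 1) < 1 := by
    refine lt_of_le_of_lt hx ?_
    exact zpow_lt_one_of_neg₀ (by exact_mod_cast hp.out.one_lt) (by lia)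
  have h2 : padicNorm p x = 1 := by
    have := padicNorm.add_eq_max_of_ne (p := p) (q := x - 1) (r := 1) (by simpa using h1.ne)
    rw [sub_add_cancel, padicNorm.one, max_eq_right h1.le] at this
    exact this
  have h3 : padicNorm p x⁻¹ = 1 := by
    rw [← one_div, padicNorm.div, h2, padicNorm.one, div_one]
  rw [DvdAt, h3, neg_zero, zpow_zero]

theorem DvdAt.mul_sub_one (hc : 0 ≤ c) (hx : DvdAt p c (x - 1)) (hy : DvdAt p c (y - 1)) :
    DvdAt p c (x * y - 1) := by
  have : x * y - 1 = (x - 1) * y + (y - 1) := by ring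
  rw [this]
  exact (hx.of_mul (hy.of_sub_one hc) (by simp)).add hy

theorem DvdAt.div_sub_one (hc : 0 < c) (hx : DvdAt p c (x - 1)) (hy : DvdAt p c (y - 1)) :
    DvdAt p c (x / y - 1) := by
  have hy0 : y ≠ 0 := by
    rintro rfl
    have := (hy.mono (l := 1) (by lia)).neg
    rw [zero_sub, neg_neg, dvdAt_iff_le_padicValRat one_ne_zero, padicValRat.one] at this
    lia
  have : x / y - 1 = ((x - 1) - (y - 1)) * y⁻¹ := by field_simp; ring
  rw [this]
  exact (hx.sub hy).of_mul (hy.inv_of_sub_one hc) (by simp)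

theorem DvdAt.prod_sub_one {ι : Type*} {s : Finset ι} {g : ι → ℚ} (hc : 0 ≤ c)
    (h : ∀ i ∈ s, DvdAt p c (g i - 1)) : DvdAt p c (∏ i ∈ s, g i - 1) :=
  prod_induction g (fun x => DvdAt p c (x - 1)) (fun _ _ => DvdAt.mul_sub_one hc)
    (by simpa using DvdAt.zero) h

end DvdAtSubOne

/-- The product of the positive integers less than `n` which are prime to `p`. -/
def coprimeFactorial (p n : ℕ) : ℕ := ∏ k ∈ range n, if p ∣ k then 1 else k

section coprimeFactorial

variable {p : ℕ}

theorem not_dvd_coprimeFactorial (hp : p.Prime) (n : ℕ) : ¬ p ∣ coprimeFactorial p n := by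
  rw [coprimeFactorial, hp.prime.dvd_finsetProd_iff]
  rintro ⟨k, -, hk⟩
  split_ifs at hk with h
  · exact hp.one_lt.ne' (Nat.dvd_one.1 hk)
  · exact h hk

theorem factorial_prime_mul (hp : p.Prime) (n : ℕ) :
    (p * n).factorial = p ^ n * n.factorial * coprimeFactorial p (p * n) := by
  induction n with
  | zero => simp [coprimeFactorial]
  | succ n ih =>
    obtain ⟨r, rfl⟩ : ∃ r, p = r + 1 := ⟨p - 1, by have := hp.pos; lia⟩
    have h1 : coprimeFactorial (r + 1) ((r + 1) * (n + 1)) =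
        coprimeFactorial (r + 1) ((r + 1) * n) * ∏ i ∈ range r, ((r + 1) * n + (i + 1)) := by
      rw [coprimeFactorial, mul_add, mul_one, prod_range_add, prod_range_succ', add_zero,
        if_pos (Dvd.intro _ rfl), mul_one, coprimeFactorial]
      congr 1
      refine prod_congr rfl fun i hi => ?_
      rw [mem_range] at hi
      rw [if_neg]
      rw [Nat.dvd_add_right (Dvd.intro _ rfl)]
      exact Nat.not_dvd_of_pos_of_lt (by lia) (by lia)
    rw [h1, mul_add, mul_one, ← Nat.factorial_mul_ascFactorial, Nat.ascFactorial_eq_prod_range,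
      prod_range_succ, ih, Nat.factorial_succ, pow_succ]
    simp only [add_assoc, add_comm 1]
    ring

/-- Since p divides N, both the factors modulo N and the condition of being prime to p are
N-periodic. -/
theorem coprimeFactorial_add {N : ℕ} (hN : p ∣ N) (a : ℕ) :
    (coprimeFactorial p (a + N) : ZMod N) = coprimeFactorial p a * coprimeFactorial p N := by
  induction a with
  | zero => simp [coprimeFactorial]
  | succ a ih =>
    have hs : ∀ n, coprimeFactorial p (n + 1) =
        coprimeFactorial p n * if p ∣ n then 1 else n := fun n => by
      rw [coprimeFactorial, prod_range_succ, coprimeFactorial]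
    rw [add_right_comm, hs, hs, Nat.cast_mul, ih, Nat.cast_mul]
    simp only [Nat.dvd_add_left hN]
    split_ifs
    · simp
    · simp; ring

theorem coprimeFactorial_add_mul {N : ℕ} (hN : p ∣ N) (a b : ℕ) :
    (coprimeFactorial p (a + b * N) : ZMod N) =
      coprimeFactorial p a * coprimeFactorial p N ^ b := by
  induction b with
  | zero => simp
  | succ b ih => rw [add_mul, one_mul, ← add_assoc, coprimeFactorial_add hN, ih, pow_succ, mul_assoc]

theorem dvdAt_coprimeFactorial_div_sub_one [hp : Fact p.Prime] {t : ℕ} (ht : t ≠ 0) (a b : ℕ) :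
    DvdAt p t ((coprimeFactorial p (a + b * p ^ t) : ℚ) /
      (coprimeFactorial p a * coprimeFactorial p (p ^ t) ^ b) - 1) := by
  set D := coprimeFactorial p a * coprimeFactorial p (p ^ t) ^ b with hD
  have hpD : ¬ p ∣ D := by
    rw [hD, hp.out.dvd_mul]
    rintro (h | h)
    · exact not_dvd_coprimeFactorial hp.out _ h
    · exact not_dvd_coprimeFactorial hp.out _ (hp.out.dvd_of_dvd_pow h)
  have hD0 : D ≠ 0 := by rintro h; simp [h] at hpD
  have h1 : ((p : ℤ) ^ t) ∣ (coprimeFactorial p (a + b * p ^ t) : ℤ) - D := by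
    have := coprimeFactorial_add_mul (dvd_pow_self p ht) a b
    rw [← Nat.cast_pow, ← ZMod.intCast_zmod_eq_zero_iff_dvd]
    push_cast [hD]
    rw [this, sub_self]
  have h2 := DvdAt.inv_natCast (p := p) hD0
  rw [padicValNat.eq_zero_of_not_dvd hpD] at h2
  have h3 := (DvdAt.of_int_dvd h1).mul h2
  have hDq : (D : ℚ) ≠ 0 := by exact_mod_cast hD0
  have : (coprimeFactorial p (a + b * p ^ t) : ℚ) /
      (coprimeFactorial p a * coprimeFactorial p (p ^ t) ^ b) - 1 =
      (((coprimeFactorial p (a + b * p ^ t) : ℤ) - D : ℤ) : ℚ) * (D : ℚ)⁻¹ := by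
    have hDc : (coprimeFactorial p a : ℚ) * coprimeFactorial p (p ^ t) ^ b = D := by
      rw [hD]; push_cast; rfl
    rw [hDc]
    push_cast
    field_simp
  rw [this]
  simpa using h3

end coprimeFactorial

section ratio

variable {p : ℕ} [hp : Fact p.Prime] {M : ℕ}

theorem factorial_add_eq_prod (n k : ℕ) :
    (n + k).factorial = n.factorial * ∏ i ∈ range k, (n + (i + 1)) := by
  rw [← Nat.factorial_mul_ascFactorial, Nat.ascFactorial_eq_prod_range]
  simp only [add_assoc, add_comm 1]

theorem exists_factorial_ratio {t u v m a : ℕ} (hv : v < p)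
    (hw : M * (v + u * p) < p ^ (t + 1)) (ha : a ≤ M) :
    ∃ η : ℚ, DvdAt p ((t + 1 : ℕ) - fractCount p M (v + u * p)) (η - 1) ∧
      ((a * (v + u * p + m * p ^ (t + 1))).factorial : ℚ) * (a * u).factorial =
        ((p : ℚ) ^ (m * p ^ t) * (coprimeFactorial p (p ^ (t + 1)) : ℚ) ^ m) ^ a * η *
          ((a * (u + m * p ^ t)).factorial * (a * (v + u * p)).factorial) := by
  have hcount := fractCount_lt hp.out t.succ_pos hw
  set c : ℤ := (t + 1 : ℕ) - fractCount p M (v + u * p)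
  have hc : 0 ≤ c := by lia
  set φ₂ := coprimeFactorial p (p * (a * (u + m * p ^ t))) with hφ₂
  set φ₁ := coprimeFactorial p (p * (a * u))
  set ε := coprimeFactorial p (p ^ (t + 1))
  have hφ₁0 : (φ₁ : ℚ) ≠ 0 := by
    intro h
    have := not_dvd_coprimeFactorial hp.out (p * (a * u))
    simp [show coprimeFactorial p (p * (a * u)) = 0 by exact_mod_cast h] at this
  have hε0 : (ε : ℚ) ≠ 0 := by
    intro h
    have := not_dvd_coprimeFactorial hp.out (p ^ (t + 1))
    simp [show coprimeFactorial p (p ^ (t + 1)) = 0 by exact_mod_cast h] at this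
  have h1 : ((a * (v + u * p + m * p ^ (t + 1))).factorial : ℚ) =
      (p : ℚ) ^ (a * (u + m * p ^ t)) * (a * (u + m * p ^ t)).factorial * φ₂ *
        ∏ i ∈ range (a * v), ((p * (a * (u + m * p ^ t)) + (i + 1) : ℕ) : ℚ) := by
    rw [show a * (v + u * p + m * p ^ (t + 1)) = p * (a * (u + m * p ^ t)) + a * v by ring,
      factorial_add_eq_prod, factorial_prime_mul hp.out]
    push_cast
    rfl
  have h2 : ((a * (v + u * p)).factorial : ℚ) =
      (p : ℚ) ^ (a * u) * (a * u).factorial * φ₁ *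
        ∏ i ∈ range (a * v), ((p * (a * u) + (i + 1) : ℕ) : ℚ) := by
    rw [show a * (v + u * p) = p * (a * u) + a * v by ring,
      factorial_add_eq_prod, factorial_prime_mul hp.out]
    push_cast
    rfl
  set P₂ := ∏ i ∈ range (a * v), ((p * (a * (u + m * p ^ t)) + (i + 1) : ℕ) : ℚ) with hP₂
  set P₁ := ∏ i ∈ range (a * v), ((p * (a * u) + (i + 1) : ℕ) : ℚ) with hP₁
  have hP₁0 : P₁ ≠ 0 := prod_ne_zero_iff.2 fun i _ => by positivity
  -- Each factorial splits into its part up to the last multiple p a u (resp. p a (u + m p^t)) and a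
  -- tail of a v factors. Each quotient of tail factors is 1 + a m p^(t+1) / k with v_p(k) ≤ μ(v + u
  -- p); the parts prime to p agree modulo p^(t+1).
  refine ⟨P₂ / P₁ * (φ₂ / (φ₁ * ε ^ (a * m))), DvdAt.mul_sub_one hc ?_ ?_, ?_⟩
  · rw [hP₂, hP₁, ← prod_div_distrib]
    refine DvdAt.prod_sub_one hc fun i hi => ?_
    rw [mem_range] at hi
    have hk0 : p * (a * u) + (i + 1) ≠ 0 := by lia
    have hk := padicValNat_add_le_fractCount hp.out (M := M) (L := a) (d := 0) (b := v) (m := u)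
      (k := p * (a * u) + (i + 1)) hv (by simpa using ha) (Nat.pos_of_ne_zero (by rintro rfl; simp at hi))
      (by rw [mul_comm p]; lia)
      (by rw [show a * (v + u * p) = p * (a * u) + a * v by ring]; lia)
    rw [add_zero] at hk
    have h3 : ((p * (a * (u + m * p ^ t)) + (i + 1) : ℕ) : ℚ) /
        ((p * (a * u) + (i + 1) : ℕ) : ℚ) - 1 =
        ((a * m : ℕ) : ℚ) * ((p : ℚ) ^ (t + 1) * ((p * (a * u) + (i + 1) : ℕ) : ℚ)⁻¹) := by
      have : ((p * (a * u) + (i + 1) : ℕ) : ℚ) ≠ 0 := by exact_mod_cast hk0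
      rw [div_sub_one this, div_eq_mul_inv, ← mul_assoc ((a * m : ℕ) : ℚ)]
      congr 1
      push_cast
      ring
    rw [h3]
    refine (DvdAt.natCast _).of_mul (((DvdAt.prime (p := p)).pow (t + 1)).mul
      (DvdAt.inv_natCast hk0)) ?_
    lia
  · rw [hφ₂, show p * (a * (u + m * p ^ t)) = p * (a * u) + a * m * p ^ (t + 1) by ring]
    exact (dvdAt_coprimeFactorial_div_sub_one t.succ_ne_zero _ _).mono (by lia)
  · rw [h1, h2]
    field_simp
    ring

variable {q₁ q₂ : ℕ} {e : Fin q₁ → ℕ} {f : Fin q₂ → ℕ}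

theorem exists_prod_factorial_ratio {t u v m q : ℕ} {c : Fin q → ℕ} (hv : v < p)
    (hw : M * (v + u * p) < p ^ (t + 1)) (hc : ∀ i, c i ≤ M) :
    ∃ η : ℚ, DvdAt p ((t + 1 : ℕ) - fractCount p M (v + u * p)) (η - 1) ∧
      (∏ i, ((c i * (v + u * p + m * p ^ (t + 1))).factorial : ℚ)) *
          ∏ i, ((c i * u).factorial : ℚ) =
        ((p : ℚ) ^ (m * p ^ t) * (coprimeFactorial p (p ^ (t + 1)) : ℚ) ^ m) ^ size c * η *
          ((∏ i, ((c i * (u + m * p ^ t)).factorial : ℚ)) *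
            ∏ i, ((c i * (v + u * p)).factorial : ℚ)) := by
  have hcount := fractCount_lt hp.out t.succ_pos hw
  choose η h1 h2 using fun i => exists_factorial_ratio (m := m) hv hw (hc i)
  refine ⟨∏ i, η i, DvdAt.prod_sub_one (by lia) fun i _ => h1 i, ?_⟩
  rw [← prod_mul_distrib, prod_congr rfl fun i _ => h2 i, prod_mul_distrib, prod_mul_distrib,
    prod_mul_distrib, prod_pow_eq_pow_sum, size]

/-- The basic congruence between the values of `factRatio` at `w` and `w + m p ^ (t + 1)`. -/
theorem exists_factRatio_ratio (hsize : size e = size f) {t u v m : ℕ} (hv : v < p)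
    (hw : maxTerm e f * (v + u * p) < p ^ (t + 1)) :
    ∃ ρ : ℚ, DvdAt p ((t + 1 : ℕ) - fractCount p (maxTerm e f) (v + u * p)) (ρ - 1) ∧
      factRatio e f (v + u * p + m * p ^ (t + 1)) / factRatio e f (v + u * p) =
        ρ * (factRatio e f (u + m * p ^ t) / factRatio e f u) := by
  have hcount := fractCount_lt hp.out t.succ_pos hw
  obtain ⟨η₁, h1, h1'⟩ := exists_prod_factorial_ratio (m := m) (c := e) hv hw le_maxTerm_left
  obtain ⟨η₂, h2, h2'⟩ := exists_prod_factorial_ratio (m := m) (c := f) hv hw le_maxTerm_right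
  refine ⟨η₁ / η₂, DvdAt.div_sub_one (by lia) h1 h2, ?_⟩
  -- With equal sizes, numerator and denominator carry the same power of the common constant, which
  -- cancels.
  rw [hsize] at h1'
  have hpos : ∀ {q : ℕ} (c : Fin q → ℕ) (n : ℕ), (∏ i, ((c i * n).factorial : ℚ)) ≠ 0 :=
    fun c n => prod_ne_zero_iff.2 fun i _ => by positivity
  have hη₂ : η₂ ≠ 0 := by
    rintro rfl
    rw [mul_zero, zero_mul] at h2'
    exact mul_ne_zero (hpos _ _) (hpos _ _) h2'
  have hK : ((p : ℚ) ^ (m * p ^ t) * (coprimeFactorial p (p ^ (t + 1)) : ℚ) ^ m) ^ size f ≠ 0 := by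
    intro h0
    rw [h0, zero_mul, zero_mul] at h2'
    exact mul_ne_zero (hpos _ _) (hpos _ _) h2'
  simp only [factRatio]
  have e1 := hpos e (v + u * p + m * p ^ (t + 1))
  have e2 := hpos e u
  have e3 := hpos e (u + m * p ^ t)
  have e4 := hpos e (v + u * p)
  have f1 := hpos f (v + u * p + m * p ^ (t + 1))
  have f2 := hpos f u
  have f3 := hpos f (u + m * p ^ t)
  have f4 := hpos f (v + u * p)
  generalize (∏ i, ((e i * (v + u * p + m * p ^ (t + 1))).factorial : ℚ)) = A1 at *
  generalize (∏ i, ((e i * u).factorial : ℚ)) = A2 at *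
  generalize (∏ i, ((e i * (u + m * p ^ t)).factorial : ℚ)) = A3 at *
  generalize (∏ i, ((e i * (v + u * p)).factorial : ℚ)) = A4 at *
  generalize (∏ i, ((f i * (v + u * p + m * p ^ (t + 1))).factorial : ℚ)) = B1 at *
  generalize (∏ i, ((f i * u).factorial : ℚ)) = B2 at *
  generalize (∏ i, ((f i * (u + m * p ^ t)).factorial : ℚ)) = B3 at *
  generalize (∏ i, ((f i * (v + u * p)).factorial : ℚ)) = B4 at *
  generalize ((p : ℚ) ^ (m * p ^ t) * (coprimeFactorial p (p ^ (t + 1)) : ℚ) ^ m) ^ size f = K at *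
  have key : (A1 * A2) * (K * η₂ * (B3 * B4)) = (B1 * B2) * (K * η₁ * (A3 * A4)) := by
    rw [h1', h2']; ring
  field_simp
  apply mul_left_cancel₀ hK
  linear_combination key

end ratio

end MirrorType

/-! ### Dwork's congruences for block sums. -/

namespace MirrorType

open Finset PowerSeries

/-- The sum of the `p ^ s` terms of index `m p ^ s, …, (m + 1) p ^ s - 1` of a sequence. -/
def blockSum {A : Type*} [AddCommMonoid A] (p : ℕ) (a : ℕ → A) : ℕ → ℕ → A
  | 0, m => a m
  | s + 1, m => ∑ v ∈ range p, blockSum p a s (v + m * p)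

theorem sum_range_mul_eq {A : Type*} [AddCommMonoid A] (p : ℕ) (a : ℕ → A) (N : ℕ) :
    ∑ j ∈ range (N * p), a j = ∑ m ∈ range N, ∑ v ∈ range p, a (v + m * p) := by
  induction N with
  | zero => simp
  | succ N ih =>
    rw [add_mul, one_mul, sum_range_succ, ← ih, sum_range_add]
    simp only [add_comm]

theorem sum_blockSum {A : Type*} [AddCommMonoid A] (p : ℕ) (a : ℕ → A) (s N : ℕ) :
    ∑ m ∈ range N, blockSum p a s m = ∑ j ∈ range (N * p ^ s), a j := by
  induction s generalizing N with
  | zero => simp [blockSum]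
  | succ s ih =>
    simp only [blockSum]
    rw [← sum_range_mul_eq, ih, pow_succ', mul_assoc]

/-- The series `∑_{v < p} Q(v + j p) z ^ (v + j p) - Q(j) z ^ (j p) φ(z)`. -/
noncomputable def dworkTerm (p : ℕ) (Q : ℕ → ℚ) (φ : PowerSeries ℚ) (j : ℕ) : PowerSeries ℚ :=
  ∑ v ∈ range p, monomial (v + j * p) (Q (v + j * p)) - monomial (j * p) (Q j) * φ

section Dwork

variable {p M : ℕ} [hp : Fact p.Prime] {Q : ℕ → ℚ} {φ : PowerSeries ℚ}

/-- The term of index j starts in degree at least j p, so a finite sum computes low coefficients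
exactly. -/
theorem coeff_sum_mul_dworkTerm (c : ℕ → ℚ) {J n : ℕ} (hn : n < J * p) :
    coeff n (∑ j ∈ range J, C (c j) * dworkTerm p Q φ j) =
      coeff n (PowerSeries.mk (fun i => c (i / p) * Q i) -
        PowerSeries.expand p hp.out.ne_zero (PowerSeries.mk fun j => c j * Q j) * φ) := by
  have hmon : ∀ (i : ℕ) (x y : ℚ), C x * monomial i y = monomial i (x * y) := by
    intro i x y
    rw [← smul_eq_C_mul, ← map_smul, smul_eq_mul]
  have h1 : ∑ j ∈ range J, C (c j) * ∑ v ∈ range p, monomial (v + j * p) (Q (v + j * p)) =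
      ∑ i ∈ range (J * p), monomial i (c (i / p) * Q i) := by
    rw [sum_range_mul_eq]
    refine sum_congr rfl fun j _ => ?_
    rw [mul_sum]
    refine sum_congr rfl fun v hv => ?_
    rw [hmon, Nat.add_mul_div_right _ _ hp.out.pos, Nat.div_eq_of_lt (mem_range.1 hv), zero_add]
  have h2 : ∑ j ∈ range J, C (c j) * (monomial (j * p) (Q j) * φ) =
      PowerSeries.expand p hp.out.ne_zero (∑ j ∈ range J, monomial j (c j * Q j)) * φ := by
    rw [map_sum, sum_mul]
    refine sum_congr rfl fun j _ => ?_
    rw [← mul_assoc, hmon, expand_monomial, mul_comm p]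
  have hsum : ∀ (g : ℕ → ℚ) (K i : ℕ), i < K →
      coeff i (∑ j ∈ range K, monomial j (g j)) = g i := by
    intro g K i hi
    simp [coeff_monomial, hi]
  simp only [dworkTerm, mul_sub]
  rw [sum_sub_distrib, h1, h2, map_sub, map_sub, hsum _ _ _ hn, coeff_mk, coeff_mul, coeff_mul]
  congr 1
  refine sum_congr rfl fun i hi => ?_
  rw [HasAntidiagonal.mem_antidiagonal] at hi
  rw [coeff_expand, coeff_expand, hsum _ _ _ (Nat.div_lt_of_lt_mul (by rw [mul_comm]; lia)),
    coeff_mk]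

theorem coeff_sum_dworkTerm
    (hφ : PowerSeries.mk Q = PowerSeries.expand p hp.out.ne_zero (PowerSeries.mk Q) * φ)
    {J n : ℕ} (hn : n < J * p) : coeff n (∑ j ∈ range J, dworkTerm p Q φ j) = 0 := by
  have := coeff_sum_mul_dworkTerm (Q := Q) (φ := φ) (fun _ => 1) hn
  simp only [map_one, one_mul] at this
  rw [this, ← hφ, sub_self, map_zero]

/-- The properties of a sequence `Q` of rational numbers from which Dwork's congruences follow. -/
structure DworkSeq (p M : ℕ) (Q : ℕ → ℚ) : Prop where
  apply_zero : Q 0 = 1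
  ne_zero : ∀ n, Q n ≠ 0
  dvdAt : ∀ n, DvdAt p (fractCount p M n) (Q n)
  ratio : ∀ t u v m, v < p → M * (v + u * p) < p ^ (t + 1) →
    ∃ ρ : ℚ, DvdAt p ((t + 1 : ℕ) - fractCount p M (v + u * p)) (ρ - 1) ∧
      Q (v + u * p + m * p ^ (t + 1)) / Q (v + u * p) = ρ * (Q (u + m * p ^ t) / Q u)

/-- Dropping the digits of u one by one changes the ratio by p-integral factors only, down to
Q(m)/Q(0) = Q(m). -/
theorem DworkSeq.dvdAt_ratio (hQ : DworkSeq p M Q) (hM : 0 < M) (m : ℕ) {t u : ℕ}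
    (hu : M * u < p ^ t) : DvdAt p (fractCount p M m) (Q (u + m * p ^ t) / Q u) := by
  induction t generalizing u with
  | zero =>
    have : u = 0 := by
      rw [pow_zero, Nat.lt_one_iff, mul_eq_zero] at hu
      lia
    simpa [this, hQ.apply_zero] using hQ.dvdAt m
  | succ t ih =>
    have hd : u % p + u / p * p = u := Nat.mod_add_div' u p
    rw [← hd] at hu
    have hlt := fractCount_lt hp.out t.succ_pos hu
    obtain ⟨ρ, h1, h2⟩ := hQ.ratio t (u / p) (u % p) m (Nat.mod_lt _ hp.out.pos) hu
    rw [hd] at h1 h2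
    rw [hd] at hlt
    rw [h2]
    refine (h1.of_sub_one (by lia)).of_mul (ih ?_) (by simp)
    have : p * (M * (u / p)) < p * p ^ t := by
      rw [← pow_succ']
      refine lt_of_le_of_lt ?_ hu
      calc p * (M * (u / p)) = M * (u / p * p) := by ring
        _ ≤ _ := Nat.mul_le_mul_left _ (Nat.le_add_left _ _)
    exact lt_of_mul_lt_mul_left this (Nat.zero_le _)

theorem DworkSeq.dvdAt_ratio_sub (hQ : DworkSeq p M Q) (hM : 0 < M) (m : ℕ) {t u v : ℕ}
    (hu : M * u < p ^ t) (hv : v < p) (hn : M * (v + u * p) < p ^ (t + 1)) :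
    DvdAt p ((t + 1 : ℕ) - fractCount p M (v + u * p) + fractCount p M m)
      (Q (v + u * p + m * p ^ (t + 1)) / Q (v + u * p) - Q (u + m * p ^ t) / Q u) := by
  obtain ⟨ρ, h1, h2⟩ := hQ.ratio t u v m hv hn
  rw [h2, ← sub_one_mul]
  exact h1.mul (hQ.dvdAt_ratio hM m hu)

theorem le_fractCount_of_first (hM : 0 < M) (m : ℕ) {t u v : ℕ} (hu : M * u < p ^ t) (hv : v < p)
    (hn : p ^ (t + 1) ≤ M * (v + u * p)) :
    t + 1 ≤ fractCount p M (v + u * p) ∧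
      t + 1 + fractCount p M m ≤ fractCount p M (v + u * p + m * p ^ (t + 1)) := by
  have hlt : v + u * p < p ^ (t + 1) := by
    have : u + 1 ≤ p ^ t := (Nat.le_mul_of_pos_left u hM).trans_lt hu
    calc v + u * p < (u + 1) * p := by rw [add_mul, one_mul, add_comm]; lia
      _ ≤ p ^ t * p := Nat.mul_le_mul_right _ this
      _ = p ^ (t + 1) := (pow_succ _ _).symm
  have h := pow_le_mul_mod_of_first hu hv hn
  refine ⟨?_, add_fractCount_le hp.out hlt h⟩
  simpa [fractCount_zero] using add_fractCount_le hp.out (m := 0) hlt h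

/-- The multiplier is chosen so that the terms in φ cancel. The remaining monomials are small by the
ratio congruence, or, once the index over p^(s+1) reaches 1/M, separately. -/
theorem DworkSeq.dworkTerm_sub (hQ : DworkSeq p M Q) (hM : 0 < M) (m : ℕ) {s u : ℕ}
    (hu : M * u < p ^ s) :
    SeriesDvdAt p (s + 1 + fractCount p M m) (dworkTerm p Q φ (u + m * p ^ s) -
      monomial (m * p ^ (s + 1)) (Q (u + m * p ^ s) / Q u) * dworkTerm p Q φ u) := by
  set R := Q (u + m * p ^ s) / Q u with hR
  have hRu : R * Q u = Q (u + m * p ^ s) := div_mul_cancel₀ _ (hQ.ne_zero u)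
  have key : dworkTerm p Q φ (u + m * p ^ s) -
      monomial (m * p ^ (s + 1)) R * dworkTerm p Q φ u =
      ∑ v ∈ range p, monomial (v + u * p + m * p ^ (s + 1))
        (Q (v + u * p + m * p ^ (s + 1)) - R * Q (v + u * p)) := by
    simp only [dworkTerm, mul_sub, mul_sum, map_sub, sum_sub_distrib, ← mul_assoc,
      monomial_mul_monomial, hRu]
    have h1 : ∀ v, v + (u + m * p ^ s) * p = v + u * p + m * p ^ (s + 1) := fun v => by ring
    have h2 : ∀ v, m * p ^ (s + 1) + (v + u * p) = v + u * p + m * p ^ (s + 1) := fun v => by ring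
    have h3 : m * p ^ (s + 1) + u * p = (u + m * p ^ s) * p := by ring
    simp only [h1, h2, h3]
    abel
  rw [key]
  refine SeriesDvdAt.sum fun v hv => SeriesDvdAt.monomial ?_ _
  rw [mem_range] at hv
  rcases lt_or_ge (M * (v + u * p)) (p ^ (s + 1)) with hn | hn
  · have h1 := (hQ.dvdAt_ratio_sub hM m hu hv hn).mul (hQ.dvdAt (v + u * p))
    rw [sub_mul, div_mul_cancel₀ _ (hQ.ne_zero _), ← hR] at h1
    exact h1.mono (by push_cast; lia)
  · obtain ⟨h1, h2⟩ := le_fractCount_of_first hM m hu hv hn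
    exact ((hQ.dvdAt _).mono (by lia)).sub
      ((hQ.dvdAt_ratio hM m hu).of_mul (hQ.dvdAt _) (by lia))

/-- Splitting a block lowers r and adds a digit to u, with r + t = s fixed. While the index over
p^(t+1) stays below 1/M, changing the multiplier loses μ(v + u p), which the shorter block regains;
at the first crossing both blocks are small separately. -/
theorem DworkSeq.blockSum_sub (hQ : DworkSeq p M Q) (hM : 0 < M) (m : ℕ) {s : ℕ}
    (ih : ∀ r < s, ∀ n, SeriesDvdAt p (r + 1 + fractCount p M n)
      (blockSum p (dworkTerm p Q φ) r n)) (r : ℕ) :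
    ∀ t u, r + t = s → M * u < p ^ t → SeriesDvdAt p (s + 1 + fractCount p M m)
      (blockSum p (dworkTerm p Q φ) r (u + m * p ^ t) -
        monomial (m * p ^ (s + 1)) (Q (u + m * p ^ t) / Q u) *
          blockSum p (dworkTerm p Q φ) r u) := by
  induction r with
  | zero =>
    intro t u ht hu
    rw [zero_add] at ht
    subst ht
    exact hQ.dworkTerm_sub hM m hu
  | succ r ihr =>
    intro t u ht hu
    simp only [blockSum]
    rw [mul_sum, ← sum_sub_distrib]
    refine SeriesDvdAt.sum fun v hv => ?_
    rw [mem_range] at hv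
    rw [show v + (u + m * p ^ t) * p = v + u * p + m * p ^ (t + 1) by ring]
    have hrs : r < s := by lia
    rcases lt_or_ge (M * (v + u * p)) (p ^ (t + 1)) with hn | hn
    · have h1 := ihr (t + 1) (v + u * p) (by lia) hn
      have h2 := (SeriesDvdAt.monomial (hQ.dvdAt_ratio_sub hM m hu hv hn)
        (m * p ^ (s + 1))).of_mul (j := s + 1 + fractCount p M m) (ih r hrs (v + u * p)) (by
          push_cast; lia)
      rw [map_sub, sub_mul] at h2
      simpa using h1.add h2
    · obtain ⟨h1, h2⟩ := le_fractCount_of_first hM m hu hv hn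
      exact ((ih r hrs _).mono (by lia)).sub
        ((SeriesDvdAt.monomial (hQ.dvdAt_ratio hM m hu) _).of_mul (ih r hrs _) (by lia))

/-- Dwork's congruences for the truncations of the generating series of `Q`. -/
theorem DworkSeq.blockSum_dworkTerm (hQ : DworkSeq p M Q) (hM : 0 < M)
    (hφ : PowerSeries.mk Q = PowerSeries.expand p hp.out.ne_zero (PowerSeries.mk Q) * φ) (s : ℕ) :
    ∀ m, SeriesDvdAt p (s + 1 + fractCount p M m) (blockSum p (dworkTerm p Q φ) s m) := by
  induction s using Nat.strong_induction_on with
  | _ s ih =>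
    have hsub : ∀ m, SeriesDvdAt p (s + 1 + fractCount p M m)
        (blockSum p (dworkTerm p Q φ) s m -
          monomial (m * p ^ (s + 1)) (Q m) * blockSum p (dworkTerm p Q φ) s 0) := by
      intro m
      simpa [hQ.apply_zero] using hQ.blockSum_sub (φ := φ) hM m ih s 0 0 rfl (by simp)
    have hint : ∀ m, DvdAt p 0 (Q m) := fun m => (hQ.dvdAt m).mono (by lia)
    -- All blocks together vanish in low degrees by `hφ`. By `hsub` their sum is congruent to block
    -- 0 times ∑ Q(m) z^(m p^(s+1)), which has constant term 1 and can be divided out.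
    have hzero : SeriesDvdAt p (s + 1) (blockSum p (dworkTerm p Q φ) s 0) := by
      intro n
      have hpos : 0 < p ^ (s + 1) := pow_pos hp.out.pos _
      refine DvdAt.coeff_of_mul (N := n + 1)
        (u := ∑ m ∈ range (n + 1), monomial (m * p ^ (s + 1)) (Q m))
        (.sum fun m _ => .monomial (hint m) _) ?_ ?_ n n.lt_succ_self
      · rw [map_sum, sum_range_succ', zero_mul, monomial_zero_eq_C_apply, constantCoeff_C,
          hQ.apply_zero, add_eq_right]
        refine sum_eq_zero fun m _ => ?_
        rw [← coeff_zero_eq_constantCoeff_apply, coeff_monomial, if_neg]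
        exact (Nat.mul_pos m.succ_pos hpos).ne
      · intro i hi
        have h1 : SeriesDvdAt p (s + 1) (∑ m ∈ range (n + 1), (blockSum p (dworkTerm p Q φ) s m -
            monomial (m * p ^ (s + 1)) (Q m) * blockSum p (dworkTerm p Q φ) s 0)) :=
          .sum fun m _ => (hsub m).mono (by lia)
        have h2 := h1 i
        rw [sum_sub_distrib, sum_blockSum, map_sub, coeff_sum_dworkTerm hφ, zero_sub, ← sum_mul,
          mul_comm] at h2
        · simpa using h2.neg
        · rw [mul_assoc, ← pow_succ]
          exact hi.trans_le (Nat.le_mul_of_pos_right _ hpos)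
    intro m
    have := (hsub m).add ((SeriesDvdAt.monomial (hQ.dvdAt m) (m * p ^ (s + 1))).of_mul hzero
      (j := s + 1 + fractCount p M m) (by lia))
    simpa using this

/-- The consequence of Dwork's congruences for series twisted by a sequence `c` varying slowly. -/
theorem DworkSeq.mk_sub_expand_mul (hQ : DworkSeq p M Q) (hM : 0 < M)
    (hφ : PowerSeries.mk Q = PowerSeries.expand p hp.out.ne_zero (PowerSeries.mk Q) * φ)
    {c : ℕ → ℚ} {k : ℤ} (hc0 : c 0 = 0)
    (hc : ∀ s m b : ℕ, b < p → DvdAt p (k - (s + 1) - fractCount p M (b + m * p))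
      (c ((b + m * p) * p ^ s) - c (m * p ^ (s + 1)))) :
    SeriesDvdAt p k (PowerSeries.mk (fun i => c (i / p) * Q i) -
      PowerSeries.expand p hp.out.ne_zero (PowerSeries.mk fun j => c j * Q j) * φ) := by
  -- Summation by parts: on passing to larger blocks, each increment of c multiplies a block sum,
  -- whose divisibility s + 1 + μ is what `hc` lacks.
  have key : ∀ s m, SeriesDvdAt p k (blockSum p (fun j => C (c j) * dworkTerm p Q φ j) s m -
      C (c (m * p ^ s)) * blockSum p (dworkTerm p Q φ) s m) := by
    intro s
    induction s with
    | zero => intro m; simpa [blockSum] using SeriesDvdAt.zero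
    | succ s ih =>
      intro m
      simp only [blockSum]
      rw [mul_sum, ← sum_sub_distrib]
      refine SeriesDvdAt.sum fun v hv => ?_
      have h1 := (SeriesDvdAt.C (hc s m v (mem_range.1 hv))).of_mul (j := k)
        (hQ.blockSum_dworkTerm hM hφ s (v + m * p)) (by lia)
      rw [map_sub, sub_mul] at h1
      simpa using (ih (v + m * p)).add h1
  intro n
  have hn : n < p ^ n * p := by
    rw [← pow_succ]
    exact n.lt_succ_self.trans (Nat.lt_pow_self hp.out.one_lt)
  rw [← coeff_sum_mul_dworkTerm c hn]
  have h1 := key n 0 n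
  have h2 := sum_blockSum p (fun j => C (c j) * dworkTerm p Q φ j) n 1
  rw [Finset.range_one, Finset.sum_singleton, one_mul] at h2
  rw [zero_mul, hc0, map_zero, zero_mul, sub_zero, h2] at h1
  exact h1

end Dwork

end MirrorType

/-! ### Harmonic numbers and the final assembly. -/

namespace MirrorType

open Finset PowerSeries

section harmonic

variable {p : ℕ} [hp : Fact p.Prime] {M L d : ℕ}

theorem harmonic_sub_harmonic {m n : ℕ} (h : m ≤ n) :
    harmonic n - harmonic m = ∑ i ∈ Ico m n, ((i + 1 : ℕ) : ℚ)⁻¹ :=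
  (sum_Ico_eq_sub _ h).symm

/-- The terms 1/i with p ∣ i add up to H_n / p; the others are p-integral. -/
theorem dvdAt_prime_mul_harmonic_sub (n : ℕ) :
    DvdAt p 1 (p * harmonic (p * n) - harmonic n) := by
  induction n with
  | zero => simpa using DvdAt.zero
  | succ n ih =>
    obtain ⟨r, hr⟩ : ∃ r, p = r + 1 := ⟨p - 1, by have := hp.out.pos; lia⟩
    have hp0 : (p : ℚ) ≠ 0 := by exact_mod_cast hp.out.ne_zero
    have h1 : harmonic (p * (n + 1)) = harmonic (p * n) +
        (∑ i ∈ range r, ((p * n + i + 1 : ℕ) : ℚ)⁻¹ + (p * (n + 1) : ℚ)⁻¹) := by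
      have : p * (n + 1) = p * n + (r + 1) := by rw [mul_add, mul_one, ← hr]
      rw [harmonic, harmonic, this, sum_range_add, sum_range_succ,
        show p * n + r + 1 = p * (n + 1) by rw [mul_add]; lia, Nat.cast_mul, Nat.cast_add_one]
    have h2 : (p : ℚ) * harmonic (p * (n + 1)) - harmonic (n + 1) =
        (p * harmonic (p * n) - harmonic n) +
          p * ∑ i ∈ range r, ((p * n + i + 1 : ℕ) : ℚ)⁻¹ := by
      rw [h1, harmonic_succ, mul_inv]
      push_cast
      field_simp
      ring
    rw [h2]
    refine ih.add (DvdAt.prime.of_mul (l := 0) (DvdAt.sum fun i hi => ?_) (by simp))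
    rw [mem_range] at hi
    have h3 := DvdAt.inv_natCast (p := p) (n := p * n + i + 1) (by lia)
    rwa [padicValNat.eq_zero_of_not_dvd, Nat.cast_zero, neg_zero] at h3
    rw [add_assoc, Nat.dvd_add_right (Dvd.intro _ rfl)]
    exact Nat.not_dvd_of_pos_of_lt (by lia) (by lia)

/-- A denominator p^s k in this range has L m p < k ≤ L (b + m p), so v_p(k) + d ≤ μ(b + m p). One
not divisible by p^s has valuation below s, and d ≤ μ(b + m p). -/
theorem dvdAt_harmonic_sub (hL : 0 < L) (hd : L * p ^ d ≤ M) {s m b : ℕ} (hb : b < p) :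
    DvdAt p (d - s - fractCount p M (b + m * p))
      (harmonic (L * ((b + m * p) * p ^ s)) - harmonic (L * (m * p ^ (s + 1)))) := by
  have hps : 0 < p ^ s := pow_pos hp.out.pos s
  have hle : L * (m * p ^ (s + 1)) ≤ L * ((b + m * p) * p ^ s) := by
    refine Nat.mul_le_mul_left _ ?_
    rw [pow_succ', ← mul_assoc]
    exact Nat.mul_le_mul_right _ (Nat.le_add_left _ _)
  rw [harmonic_sub_harmonic hle]
  refine DvdAt.sum fun i hi => (DvdAt.inv_natCast (by lia)).mono ?_
  rw [mem_Ico] at hi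
  suffices h : padicValNat p (i + 1) + d ≤ s + fractCount p M (b + m * p) by lia
  by_cases hdvd : p ^ s ∣ i + 1
  · obtain ⟨k, hk⟩ := hdvd
    have hk0 : k ≠ 0 := by rintro rfl; lia
    have h1 : L * m * p < k := by
      have : p ^ s * (L * m * p) < p ^ s * k := by
        rw [← hk, show p ^ s * (L * m * p) = L * (m * p ^ (s + 1)) by ring]
        lia
      exact lt_of_mul_lt_mul_left this (Nat.zero_le _)
    have h2 : k ≤ L * (b + m * p) := by
      have : p ^ s * k ≤ p ^ s * (L * (b + m * p)) := by
        rw [← hk, show p ^ s * (L * (b + m * p)) = L * ((b + m * p) * p ^ s) by ring]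
        lia
      exact Nat.le_of_mul_le_mul_left this hps
    have h3 := padicValNat_add_le_fractCount hp.out hb hd hL h1 h2
    rw [hk, padicValNat.mul hps.ne' hk0, padicValNat.prime_pow]
    lia
  · have h1 : padicValNat p (i + 1) < s := by
      by_contra h
      exact hdvd ((padicValNat_dvd_iff_le (by lia)).2 (not_lt.1 h))
    have h2 : d ≤ fractCount p M (b + m * p) := by
      refine le_fractCount_of_pos hp.out ((Nat.le_mul_of_pos_left _ hL).trans hd) ?_
      by_contra h0
      rw [Nat.eq_zero_of_not_pos h0] at hi
      lia
    lia

variable {Q : ℕ → ℚ}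

/-- H_{L p ⌊w/p⌋} is inserted as an intermediate value; for w > 0, d ≤ μ(w) supplies the missing
factor p^d. -/
theorem DworkSeq.dvdAt_mul_harmonic_sub (hQ : DworkSeq p M Q) (hL : 0 < L) (hd : L * p ^ d ≤ M)
    (w : ℕ) : DvdAt p (1 + d) (p * (Q w * harmonic (L * w)) - harmonic (L * (w / p)) * Q w) := by
  have hb : w % p < p := Nat.mod_lt _ hp.out.pos
  have hw : w % p + w / p * p = w := Nat.mod_add_div' w p
  have h1 := dvdAt_harmonic_sub hL hd (s := 0) (m := w / p) hb
  rw [pow_zero, mul_one, zero_add, pow_one, hw] at h1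
  have h2 := dvdAt_prime_mul_harmonic_sub (p := p) (L * (w / p))
  have h3 := (DvdAt.prime.mul (hQ.dvdAt w)).of_mul (j := 1 + d) h1 (by push_cast; lia)
  have h4 : DvdAt p (1 + d)
      (Q w * (p * harmonic (p * (L * (w / p))) - harmonic (L * (w / p)))) := by
    rcases Nat.eq_zero_or_pos w with rfl | h0
    · simpa using DvdAt.zero
    · have := le_fractCount_of_pos hp.out ((Nat.le_mul_of_pos_left _ hL).trans hd) h0
      exact (hQ.dvdAt w).of_mul h2 (by lia)
  convert h3.add h4 using 1
  rw [show p * (L * (w / p)) = L * (w / p * p) by ring]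
  ring

end harmonic

theorem pow_padicValNat_lcm_le {p : ℕ} [hp : Fact p.Prime] {N : ℕ} (hN : N ≠ 0) :
    p ^ padicValNat p ((Icc 1 N).lcm id) ≤ N := by
  have key : ∀ s : Finset ℕ, s ⊆ Icc 1 N → s.lcm id ≠ 0 ∧
      padicValNat p (s.lcm id) ≤ Nat.log p N := by
    intro s
    induction s using Finset.induction_on with
    | empty => simp
    | insert a s ha ih =>
      intro hs
      obtain ⟨h1, h2⟩ := ih ((subset_insert _ _).trans hs)
      have ha := mem_Icc.1 (hs (mem_insert_self a s))
      have ha0 : a ≠ 0 := by lia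
      rw [lcm_insert, id]
      refine ⟨Nat.lcm_ne_zero ha0 h1, ?_⟩
      change padicValNat p (Nat.lcm a _) ≤ _
      rw [← Nat.factorization_def _ hp.out, Nat.factorization_lcm ha0 h1, Finsupp.sup_apply,
        Nat.factorization_def _ hp.out, Nat.factorization_def _ hp.out]
      exact max_le ((padicValNat_le_nat_log a).trans (Nat.log_mono_right ha.2)) h2
  exact (Nat.pow_le_pow_right hp.out.pos (key _ subset_rfl).2).trans (Nat.pow_log_le_self p hN)

theorem dworkSeq_factRatio {q₁ q₂ : ℕ} {e : Fin q₁ → ℕ} {f : Fin q₂ → ℕ}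
    (hsize : size e = size f)
    (hΔ : ∀ x ∈ Set.Ico (1 / (maxTerm e f : ℝ)) 1, 1 ≤ landau e f x) (p : ℕ) [Fact p.Prime] :
    DworkSeq p (maxTerm e f) (factRatio e f) where
  apply_zero := by simp [factRatio]
  ne_zero := factRatio_ne_zero
  dvdAt := dvdAt_factRatio hsize hΔ
  ratio _ _ _ _ hv hw := exists_factRatio_ratio hsize hv hw

end MirrorType

open MirrorType PowerSeries in
theorem mainTheorem1 {q₁ q₂ : ℕ} (e : Fin q₁ → ℕ) (f : Fin q₂ → ℕ)
    (he : ∀ i, 0 < e i) (hf : ∀ j, 0 < f j)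
    (hdisj : ∀ i j, e i ≠ f j)
    (hsize : MirrorType.size e = MirrorType.size f)
    (hΔ : ∀ x ∈ Set.Ico (1 / (MirrorType.maxTerm e f : ℝ)) 1, 1 ≤ MirrorType.landau e f x) :
    ∀ L ∈ Finset.Icc 1 (MirrorType.maxTerm e f),
      MirrorType.HasIntegralRoot (MirrorType.mirrorType L e f) (MirrorType.lcmUpTo L e f) := by
  intro L hL
  rw [Finset.mem_Icc] at hL
  have hN : maxTerm e f / L ≠ 0 := (Nat.div_pos hL.2 hL.1).ne'
  have hD : lcmUpTo L e f ≠ 0 := by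
    simp [lcmUpTo, Finset.lcm_eq_zero_iff]
  have hF1 := constantCoeff_seriesF e f
  have hG0 : constantCoeff (seriesG L e f * (seriesF e f)⁻¹) = 0 := by
    rw [map_mul, ← coeff_zero_eq_constantCoeff_apply (seriesG L e f)]
    simp [seriesG]
  refine hasIntegralRoot_exp_subst hD hG0 fun p hp => ?_
  have hpf : Fact p.Prime := ⟨hp⟩
  refine SeriesDvdAt.exp_subst (by simp [hG0]) ?_
  set D := lcmUpTo L e f
  set d := padicValNat p D
  set F := seriesF e f
  set G := seriesG L e f
  have hd : L * p ^ d ≤ maxTerm e f :=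
    (Nat.mul_le_mul_left L (pow_padicValNat_lcm_le hN)).trans (Nat.mul_div_le _ _)
  have hQ := dworkSeq_factRatio hsize hΔ p
  set φ := F * PowerSeries.expand p hp.ne_zero F⁻¹ with hφ
  have hFF : F * F⁻¹ = 1 := PowerSeries.mul_inv_cancel _ (by simp [hF1])
  have hφF : F = PowerSeries.expand p hp.ne_zero F * φ := by
    rw [hφ, mul_left_comm, ← map_mul, hFF, map_one, mul_one]
  have h1 := hQ.mk_sub_expand_mul (hL.1.trans hL.2) hφF (c := fun j => harmonic (L * j))
    (k := 1 + d) (by simp) fun s m b hb =>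
      (dvdAt_harmonic_sub hL.1 hd hb).mono (by lia)
  have h2 : SeriesDvdAt p (1 + d) ((p : PowerSeries ℚ) * G -
      PowerSeries.mk fun i => harmonic (L * (i / p)) * factRatio e f i) := by
    intro w
    rw [map_sub, coeff_mk, ← map_natCast (PowerSeries.C (R := ℚ)), coeff_C_mul]
    simpa [G, seriesG] using hQ.dvdAt_mul_harmonic_sub hL.1 hd w
  have hG : (PowerSeries.mk fun j => harmonic (L * j) * factRatio e f j) = G := by
    ext n; simp [G, seriesG, mul_comm]
  rw [hG] at h1
  have hDinv := DvdAt.inv_natCast (p := p) hD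
  have hint : SeriesDvdAt p 0 F := fun n => by
    simpa [F, seriesF] using (hQ.dvdAt n).mono (by lia)
  -- Multiplying by F clears F⁻¹ and turns F · F(z^p)⁻¹ into `φ`.
  refine SeriesDvdAt.of_mul_right hint hF1 ?_
  have key : (PowerSeries.expand p hp.ne_zero (PowerSeries.C (D : ℚ)⁻¹ * (G * F⁻¹)) -
      (p : PowerSeries ℚ) * (PowerSeries.C (D : ℚ)⁻¹ * (G * F⁻¹))) * F =
      PowerSeries.C (D : ℚ)⁻¹ * (0 - (((PowerSeries.mk fun i => harmonic (L * (i / p)) *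
        factRatio e f i) - PowerSeries.expand p hp.ne_zero G * φ) + ((p : PowerSeries ℚ) * G -
      PowerSeries.mk fun i => harmonic (L * (i / p)) * factRatio e f i))) := by
    rw [hφ, map_mul, map_mul, expand_C]
    linear_combination (-(p : PowerSeries ℚ) * PowerSeries.C (D : ℚ)⁻¹ * G) * hFF
  rw [key]
  exact (SeriesDvdAt.C hDinv).of_mul (SeriesDvdAt.zero.sub (h1.add h2)) (by lia)
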